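/- Let $\mu>-\tfrac12$ be real. Let $\Phi(a,c,z)=\sum_{n\ge 0}\frac{(a)_n}{(c)_n}\frac{z^n}{n!}$ be Kummer's confluent hypergeometric function, where $(a)_n=a(a+1)\cdots(a+n-1)$, and put $\mathbf e_\mu(z)=e^{z}\,\Phi(\mu,2\mu+1,-2z)$ for $z\in\mathbb C$. Let $L^2_\mu(\mathbb R)$ be the complex Hilbert space $L^2(\mathbb R,|t|^{2\mu}dt)$. For $a>0$ let $\mathfrak S_a$ be the complex linear span of the functions $t\mapsto e^{-at^2}t^n$, $n=0,1,2,\dots$. For $m\ge 0$ define $$\gamma_\mu(2m)=\frac{2^{2m}m!\,\Gamma(m+\mu+\frac12)}{\Gamma(\mu+\frac12)},\qquad \gamma_\mu(2m+1)=\frac{2^{2m+1}m!\,\Gamma(m+\mu+\frac32)}{\Gamma(\mu+\frac12)},$$ the generalized Hermite polynomials $$H^\mu_{2m}(x)=(-1)^m\frac{(2m)!}{m!}\sum_{k=0}^m(-1)^k\binom mk\frac{\Gamma(\mu+\frac12)}{\Gamma(k+\mu+\frac12)}x^{2k},$$ $$H^\mu_{2m+1}(x)=(-1)^m\frac{(2m+1)!}{m!}\sum_{k=0}^m(-1)^k\binom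 mk\frac{\Gamma(\mu+\frac12)}{\Gamma(k+\mu+\frac32)}x^{2k+1},$$ and the generalized Hermite functions $$\phi^\mu_n(x)=\Big(\frac{\gamma_\mu(n)}{\Gamma(\mu+\frac12)}\Big)^{1/2}\frac{1}{2^{n/2}\,n!}\,e^{-x^2/2}H^\mu_n(x),\qquad n\ge 0.$$ **Theorem.** For every $a>0$ one has $\mathfrak S_a\subset L^2_\mu(\mathbb R)$, and for all $f\in\mathfrak S_a$ and $x\in\mathbb R$ the functions $t\mapsto \mathbf e_\mu(\mp ixt)f(t)|t|^{2\mu}$ are integrable. There is a unitary operator $\mathcal F_\mu$ of $L^2_\mu(\mathbb R)$ onto itself such that, for all $a>0$ and $f\in\mathfrak S_a$, $$\mathcal F_\mu f(x)=\frac{1}{2^{\mu+\frac12}\Gamma(\mu+\frac12)}\int_{-\infty}^{\infty}\mathbf e_\mu(-ixt)f(t)|t|^{2\mu}\,dt\quad\text{for almost every }x,$$ and, for each single $a>0$, it is the only bounded linear operator on $L^2_\mu(\mathbb R)$ that satisfies this formula on $\mathfrak S_a$. The eigenvalues of $\mathcal F_\mu$ are exactly $1,-1,i,-i$. The functions $\phi^\mu_n$,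 $n\ge 0$, belong to $L^2_\mu(\mathbb R)$ and form a complete orthonormal set of eigenvectors of $\mathcal F_\mu$, with $\mathcal F_\mu\phi^\mu_n=(-i)^n\phi^\mu_n$. The inverse $\mathcal F_\mu^{-1}=\mathcal F_\mu^*$ satisfies, for all $a>0$ and $f\in\mathfrak S_a$, $$\mathcal F_\mu^{-1}f(x)=\frac{1}{2^{\mu+\frac12}\Gamma(\mu+\frac12)}\int_{-\infty}^{\infty}\mathbf e_\mu(ixt)f(t)|t|^{2\mu}\,dt\quad\text{for almost every }x.$$ -/

import Mathlib

open MeasureTheory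
open scoped ENNReal Nat

noncomputable section

/-- Kummer's confluent hypergeometric function
`Φ(a, c, z) = ∑ₙ (a)ₙ / (c)ₙ * zⁿ / n!`, with `(a)ₙ = a (a + 1) ⋯ (a + n - 1)`. -/
def kummerPhi (a c z : ℂ) : ℂ :=
  ∑' n : ℕ, (ascPochhammer ℂ n).eval a / (ascPochhammer ℂ n).eval c * z ^ n / (n ! : ℂ)

/-- The generalized exponential function `e_μ(z) = e^z Φ(μ, 2μ + 1, -2z)`. -/
def genExp (μ : ℝ) (z : ℂ) : ℂ :=
  Complex.exp z * kummerPhi μ (2 * μ + 1) (-2 * z)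

/-- The generalized factorial: `γ_μ(2m) = 2^(2m) m! Γ(m + μ + 1/2) / Γ(μ + 1/2)` and
`γ_μ(2m + 1) = 2^(2m + 1) m! Γ(m + μ + 3/2) / Γ(μ + 1/2)`. -/
def genFactorial (μ : ℝ) (n : ℕ) : ℝ :=
  if Even n then
    2 ^ n * ((n / 2)! : ℝ) * Real.Gamma (((n / 2 : ℕ) : ℝ) + μ + 1 / 2) / Real.Gamma (μ + 1 / 2)
  else
    2 ^ n * ((n / 2)! : ℝ) * Real.Gamma (((n / 2 : ℕ) : ℝ) + μ + 3 / 2) / Real.Gamma (μ + 1 / 2)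

/-- The generalized Hermite polynomial `H_n^μ`, as a function on the real line. For `n = 2m` and
`n = 2m + 1` the number `m` is `n / 2`. -/
def genHermite (μ : ℝ) (n : ℕ) (x : ℝ) : ℝ :=
  if Even n then
    (-1) ^ (n / 2) * ((n ! : ℝ) / ((n / 2)! : ℝ)) *
      ∑ k ∈ Finset.range (n / 2 + 1), (-1) ^ k * ((n / 2).choose k : ℝ) *
        (Real.Gamma (μ + 1 / 2) / Real.Gamma ((k : ℝ) + μ + 1 / 2)) * x ^ (2 * k)
  else
    (-1) ^ (n / 2) * ((n ! : ℝ) / ((n / 2)! : ℝ)) *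
      ∑ k ∈ Finset.range (n / 2 + 1), (-1) ^ k * ((n / 2).choose k : ℝ) *
        (Real.Gamma (μ + 1 / 2) / Real.Gamma ((k : ℝ) + μ + 3 / 2)) * x ^ (2 * k + 1)

/-- The generalized Hermite function `φ_n^μ`. -/
def hermiteFun (μ : ℝ) (n : ℕ) (x : ℝ) : ℂ :=
  ((Real.sqrt (genFactorial μ n / Real.Gamma (μ + 1 / 2)) *
    (1 / ((2 : ℝ) ^ ((n : ℝ) / 2) * (n ! : ℝ))) *
    Real.exp (-(x ^ 2) / 2) * genHermite μ n x : ℝ) : ℂ)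

/-- The measure `|t|^(2μ) dt` on the real line. -/
def weightMeasure (μ : ℝ) : Measure ℝ :=
  volume.withDensity fun t => ENNReal.ofReal (|t| ^ (2 * μ))

/-- The Hilbert space `L²_μ(ℝ)`. -/
abbrev L2w (μ : ℝ) : Type := Lp ℂ 2 (weightMeasure μ)

/-- The linear span over `ℂ` of the functions `exp (-a t²) tⁿ`, `n = 0, 1, 2, …`. -/
def gaussSpan (a : ℝ) : Submodule ℂ (ℝ → ℂ) :=
  Submodule.span ℂ
    (Set.range fun (n : ℕ) (t : ℝ) => ((Real.exp (-(a * t ^ 2)) * t ^ n : ℝ) : ℂ))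

/-- The generalized Fourier integral, with kernel `e_μ(-ixt) |t|^(2μ)`. -/
def fourierIntegralW (μ : ℝ) (f : ℝ → ℂ) (x : ℝ) : ℂ :=
  (((2 : ℝ) ^ (μ + 1 / 2) * Real.Gamma (μ + 1 / 2) : ℝ) : ℂ)⁻¹ *
    ∫ t : ℝ, genExp μ (-Complex.I * x * t) * f t * ((|t| ^ (2 * μ) : ℝ) : ℂ)

/-- The generalized inverse Fourier integral, with kernel `e_μ(ixt) |t|^(2μ)`. -/
def fourierIntegralInvW (μ : ℝ) (f : ℝ → ℂ) (x : ℝ) : ℂ :=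
  (((2 : ℝ) ^ (μ + 1 / 2) * Real.Gamma (μ + 1 / 2) : ℝ) : ℂ)⁻¹ *
    ∫ t : ℝ, genExp μ (Complex.I * x * t) * f t * ((|t| ^ (2 * μ) : ℝ) : ℂ)

/-- The operator `G` on `L²_μ(ℝ)` is given on the span of the functions `exp (-a t²) tⁿ`, which
consists of square integrable functions, by the integral operator `T`. -/
def ExtendsOn (μ a : ℝ) (T : (ℝ → ℂ) → ℝ → ℂ) (G : L2w μ → L2w μ) : Prop :=
  ∀ f ∈ gaussSpan a, ∃ hf : MemLp f 2 (weightMeasure μ),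
    (G (hf.toLp f) : ℝ → ℂ) =ᵐ[weightMeasure μ] T f

end

/-! The proof rests on the Dunkl operator D, which sends xⁿ to d_n xⁿ⁻¹ with d_n = n + 2μ[n odd]
(`dunklCoeff`). Since γ_μ(n + 1) = d_{n+1} γ_μ(n), the numbers γ_μ(n) are the factorials belonging
to D. Kummer's equation shows that e_μ(z) = ∑ zⁿ/γ_μ(n) (`hasSum_genExp`), so e_μ(ωx) is an
eigenfunction of D with eigenvalue ω. With respect to |t|^(2μ) dt, D is antisymmetric on polynomials
times Gaussians (`gaussIntegral_dunklOp_mul`).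

Up to scalars, the Hermite functions arise from exp(-x²/2) by repeated application of x - D.
Antisymmetry gives their orthogonality. For ω = ±i it also shows that the transform with kernel
e_μ(ωxt) turns x - D into ω(x - D). It multiplies exp(-x²/2) by exactly the normalizing constant, so
φ_n is an eigenfunction with eigenvalue ωⁿ (`transform_hermiteFun`). The functions φ_n are complete
because an element of L²_μ orthogonal to all exp(-at²) tⁿ, multiplied by exp(-at²), has vanishing
Fourier transform.

The operator is therefore defined as the unitary that is diagonal in the basis φ_n, with entries
(-i)ⁿ. On the span for a = 1/2 it agrees with the integral by linearity. The other values of a are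
reached by expanding exp(-bt²) in the functions exp(-at²) t²ᵏ (`ExtendsOn.of_pos`). The same
passage, applied to an arbitrary bounded operator, gives uniqueness from any single a. -/

/-! ### Dunkl coefficients and generalized factorials -/

/-- The numbers `n + 2μ [n odd]`, the eigenvalues of the Dunkl operator on monomials. -/
noncomputable def dunklCoeff (μ : ℝ) (n : ℕ) : ℝ := if Even n then n else n + 2 * μ

theorem dunklCoeff_zero (μ : ℝ) : dunklCoeff μ 0 = 0 := by simp [dunklCoeff]

theorem dunklCoeff_of_even (μ : ℝ) {n : ℕ} (hn : Even n) : dunklCoeff μ n = n := by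
  simp [dunklCoeff, hn]

theorem dunklCoeff_of_odd (μ : ℝ) {n : ℕ} (hn : Odd n) : dunklCoeff μ n = n + 2 * μ := by
  simp [dunklCoeff, Nat.not_even_iff_odd.2 hn]

theorem dunklCoeff_add_even (μ : ℝ) {l : ℕ} (hl : Even l) (n : ℕ) :
    dunklCoeff μ (n + l) = dunklCoeff μ n + l := by
  by_cases hn : Even n
  · simp [dunklCoeff, hn, hn.add hl]
  · have : ¬ Even (n + l) := by simp [Nat.even_add, hn, hl]
    simp only [dunklCoeff, hn, this, if_false]
    push_cast
    ring

/-- A constant `ε > 0` with `ε n ≤ dunklCoeff μ n`. -/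
noncomputable def dunklLower (μ : ℝ) : ℝ := min 1 (1 + 2 * μ)

theorem dunklLower_pos {μ : ℝ} (hμ : -(1 / 2 : ℝ) < μ) : 0 < dunklLower μ := by
  unfold dunklLower
  exact lt_min one_pos (by linarith)

theorem dunklLower_mul_le {μ : ℝ} (n : ℕ) :
    dunklLower μ * n ≤ dunklCoeff μ n := by
  have h1 : dunklLower μ ≤ 1 := min_le_left _ _
  have h2 : dunklLower μ ≤ 1 + 2 * μ := min_le_right _ _
  rcases Nat.even_or_odd n with h | h
  · rw [dunklCoeff_of_even μ h]
    nlinarith [(Nat.cast_nonneg n : (0 : ℝ) ≤ n)]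
  · rw [dunklCoeff_of_odd μ h]
    have hn : (1 : ℝ) ≤ n := by exact_mod_cast h.pos
    by_cases hm : 0 ≤ μ
    · nlinarith
    · nlinarith

theorem dunklCoeff_pos {μ : ℝ} (hμ : -(1 / 2 : ℝ) < μ) {n : ℕ} (hn : 0 < n) :
    0 < dunklCoeff μ n :=
  lt_of_lt_of_le (mul_pos (dunklLower_pos hμ) (by exact_mod_cast hn)) (dunklLower_mul_le n)

theorem gamma_half_pos {μ : ℝ} (hμ : -(1 / 2 : ℝ) < μ) : 0 < Real.Gamma (μ + 1 / 2) :=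
  Real.Gamma_pos_of_pos (by linarith)

theorem genFactorial_zero {μ : ℝ} (hμ : -(1 / 2 : ℝ) < μ) : genFactorial μ 0 = 1 := by
  have := (gamma_half_pos hμ).ne'
  simp only [genFactorial, Even.zero, if_true, pow_zero, Nat.zero_div, Nat.factorial_zero,
    Nat.cast_one, Nat.cast_zero, zero_add, one_mul]
  exact div_self this

/-- From n = 2m to 2m + 1 the factor comes from Γ(s + 1) = sΓ(s) at s = m + μ + 1/2. From 2m + 1 to
2m + 2 the Gamma factors coincide, and the new factor is 2(m + 1). -/
theorem genFactorial_succ {μ : ℝ} (hμ : -(1 / 2 : ℝ) < μ) (n : ℕ) :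
    genFactorial μ (n + 1) = dunklCoeff μ (n + 1) * genFactorial μ n := by
  have hG := (gamma_half_pos hμ).ne'
  rcases Nat.even_or_odd' n with ⟨m, rfl | rfl⟩
  · have h1 : ¬ Even (2 * m + 1) := by simp
    have h2 : (2 * m + 1) / 2 = m := by omega
    have h3 : Real.Gamma ((m : ℝ) + μ + 3 / 2)
        = (m + μ + 1 / 2) * Real.Gamma ((m : ℝ) + μ + 1 / 2) := by
      rw [← Real.Gamma_add_one]
      · congr 1; ring
      · have : (0 : ℝ) ≤ m := m.cast_nonneg
        linarith
    simp only [genFactorial, dunklCoeff, h1, h2, h3, even_two_mul, if_true, if_false,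
      Nat.mul_div_cancel_left m two_pos]
    push_cast
    field_simp
    ring
  · have h1 : ¬ Even (2 * m + 1) := by simp
    have h1' : Even (2 * m + 1 + 1) := ⟨m + 1, by ring⟩
    have h2 : (2 * m + 1) / 2 = m := by omega
    have h2' : (2 * m + 1 + 1) / 2 = m + 1 := by omega
    simp only [genFactorial, dunklCoeff, h1, h1', h2, h2', if_true, if_false, Nat.factorial_succ]
    rw [show ((m + 1 : ℕ) : ℝ) + μ + 1 / 2 = m + μ + 3 / 2 by push_cast; ring]
    push_cast
    field_simp
    ring

/-- Comparison with n! bounds e_μ by an ordinary exponential. The bound is crude, but any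
exponential rate is absorbed by a Gaussian. -/
theorem genFactorial_lower {μ : ℝ} (hμ : -(1 / 2 : ℝ) < μ) (n : ℕ) :
    dunklLower μ ^ n * n ! ≤ genFactorial μ n := by
  induction n with
  | zero => simp [genFactorial_zero hμ]
  | succ n ih =>
    rw [genFactorial_succ hμ, Nat.factorial_succ, pow_succ]
    push_cast
    have h0 := dunklLower_pos hμ
    calc dunklLower μ ^ n * dunklLower μ * (((n : ℝ) + 1) * n !)
        = (dunklLower μ * ((n + 1 : ℕ) : ℝ)) * (dunklLower μ ^ n * n !) := by push_cast; ring
      _ ≤ _ := mul_le_mul (dunklLower_mul_le _) ih (by positivity)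
          (dunklCoeff_pos hμ n.succ_pos).le

theorem genFactorial_pos {μ : ℝ} (hμ : -(1 / 2 : ℝ) < μ) (n : ℕ) : 0 < genFactorial μ n := by
  have := dunklLower_pos hμ
  exact lt_of_lt_of_le (by positivity) (genFactorial_lower hμ n)

theorem inv_genFactorial_le {μ : ℝ} (hμ : -(1 / 2 : ℝ) < μ) (n : ℕ) :
    (genFactorial μ n)⁻¹ ≤ (dunklLower μ)⁻¹ ^ n / n ! := by
  have := dunklLower_pos hμ
  refine (inv_anti₀ (by positivity) (genFactorial_lower hμ n)).trans (le_of_eq ?_)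
  rw [mul_inv, inv_pow, div_eq_mul_inv]

/-! ### The power series of the generalized exponential -/

/-- Coefficients of `Φ(μ, 2μ + 1, -2z)`. -/
noncomputable def kummerCoeff (μ : ℝ) (n : ℕ) : ℂ :=
  (ascPochhammer ℂ n).eval (μ : ℂ) / (ascPochhammer ℂ n).eval (2 * μ + 1 : ℂ) * (-2) ^ n / (n ! : ℂ)

theorem kummerCoeff_denom_ne {μ : ℝ} (hμ : -(1 / 2 : ℝ) < μ) (n : ℕ) :
    (2 * (μ : ℂ) + 1 + n) ≠ 0 := by
  have : 0 < 2 * μ + 1 + n := by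
    have : (0 : ℝ) ≤ n := n.cast_nonneg
    linarith
  exact_mod_cast this.ne'

theorem kummerCoeff_succ {μ : ℝ} (hμ : -(1 / 2 : ℝ) < μ) (n : ℕ) :
    kummerCoeff μ (n + 1)
      = kummerCoeff μ n * (-2 * (μ + n) / ((2 * μ + 1 + n) * (n + 1))) := by
  have h := kummerCoeff_denom_ne hμ n
  have h2 : ((n : ℂ) + 1) ≠ 0 := by exact_mod_cast n.succ_ne_zero
  have h3 : ((n ! : ℕ) : ℂ) ≠ 0 := by exact_mod_cast n.factorial_ne_zero
  simp only [kummerCoeff, ascPochhammer_succ_eval, Nat.factorial_succ, pow_succ]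
  push_cast
  field_simp

theorem norm_kummerCoeff_le {μ : ℝ} (hμ : -(1 / 2 : ℝ) < μ) (n : ℕ) :
    ‖kummerCoeff μ n‖ ≤ (2 * (1 + |μ| / (2 * μ + 1))) ^ n / n ! := by
  have hp : 0 < 2 * μ + 1 := by linarith
  set R := 1 + |μ| / (2 * μ + 1) with hR
  have hRpos : 0 < R := by positivity
  induction n with
  | zero => simp [kummerCoeff]
  | succ n ih =>
    have hn : (0 : ℝ) ≤ n := n.cast_nonneg
    rw [kummerCoeff_succ hμ, norm_mul]
    have key : ‖(-2 * (μ + n) / ((2 * μ + 1 + n) * (n + 1)) : ℂ)‖ ≤ 2 * R / (n + 1) := by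
      have : (-2 * (μ + n) / ((2 * μ + 1 + n) * (n + 1)) : ℂ)
          = ((-2 * (μ + n) / ((2 * μ + 1 + n) * (n + 1)) : ℝ) : ℂ) := by push_cast; ring
      rw [this, Complex.norm_real, Real.norm_eq_abs, abs_div, abs_mul,
        abs_of_pos (show 0 < (2 * μ + 1 + n) * ((n : ℝ) + 1) by positivity)]
      rw [div_le_div_iff₀ (by positivity) (by positivity)]
      -- R is chosen so that R(2μ + 1) = 2μ + 1 + |μ|, which dominates |μ|. Moreover R ≥ 1 takes
      -- care of the term n.
      have h1 : |μ + n| ≤ R * (2 * μ + 1 + n) := by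
        have e : R * (2 * μ + 1) = 2 * μ + 1 + |μ| := by rw [hR]; field_simp
        have := abs_add_le μ n
        rw [abs_of_nonneg hn] at this
        have hR1 : 1 ≤ R := by rw [hR]; simp; positivity
        nlinarith
      have : |(-2 : ℝ)| = 2 := by norm_num
      rw [this]
      have := mul_le_mul_of_nonneg_right h1 (show (0 : ℝ) ≤ 2 * (n + 1) by positivity)
      nlinarith
    calc _ ≤ (2 * R) ^ n / n ! * (2 * R / (n + 1)) := by gcongr
      _ = _ := by
        rw [Nat.factorial_succ, pow_succ]; push_cast; field_simp

/-- The coefficients of `exp(z) Φ(μ, 2μ + 1, -2z)` satisfy a two term recurrence. -/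
theorem kummer_exp_recurrence {μ : ℝ} (hμ : -(1 / 2 : ℝ) < μ) (E : PowerSeries ℂ)
    (hE : E = PowerSeries.exp ℂ * PowerSeries.mk (kummerCoeff μ)) (n : ℕ) :
    ((n : ℂ) + 2) * (n + 2 + 2 * μ) * PowerSeries.coeff (n + 2) E
      = PowerSeries.coeff (n + 1) E + PowerSeries.coeff n E := by
  set g : PowerSeries ℂ := PowerSeries.mk (kummerCoeff μ) with hg
  let D := PowerSeries.derivative ℂ
  obtain ⟨c, hc⟩ : ∃ c : ℂ, c = 2 * μ := ⟨_, rfl⟩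
  -- Kummer's equation for g(z) = Φ(μ, 2μ + 1, -2z): zg'' + (2μ + 1 + 2z)g' + 2μg = 0, checked
  -- coefficient by coefficient.
  have hode : PowerSeries.X * D (D g) + (PowerSeries.C c * D g + D g)
      + PowerSeries.C 2 * (PowerSeries.X * D g) + PowerSeries.C c * g = 0 := by
    ext k
    have h := kummerCoeff_succ hμ k
    have h1 := kummerCoeff_denom_ne hμ k
    have h2 : ((k : ℂ) + 1) ≠ 0 := by exact_mod_cast k.succ_ne_zero
    rcases k with _ | k
    · simp only [map_add, PowerSeries.coeff_C_mul, PowerSeries.coeff_zero_X_mul, D,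
        PowerSeries.coeff_derivative, hg, PowerSeries.coeff_mk, h, map_zero, hc]
      field_simp
      push_cast
      ring
    · simp only [map_add, PowerSeries.coeff_C_mul, PowerSeries.coeff_succ_X_mul, D,
        PowerSeries.coeff_derivative, hg, PowerSeries.coeff_mk, h, map_zero, hc]
      field_simp
      push_cast
      ring
  have hexp : D (PowerSeries.exp ℂ) = PowerSeries.exp ℂ := PowerSeries.derivative_exp ℂ
  -- Substituting E = exp(z) g removes the term 2zg' and leaves zE'' + (2μ + 1)E' - (z + 1)E = 0.
  -- Its coefficient at zⁿ⁺¹ is the recurrence.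
  have hode2 : PowerSeries.X * D (D E) + (PowerSeries.C c * D E + D E)
      - PowerSeries.X * E - E = 0 := by
    have h1 : D E = PowerSeries.exp ℂ * (g + D g) := by
      rw [hE, Derivation.leibniz, hexp]; simp only [smul_eq_mul]; ring
    have h2 : D (D E) = PowerSeries.exp ℂ * (g + 2 * D g + D (D g)) := by
      rw [h1, Derivation.leibniz, hexp, map_add]; simp only [smul_eq_mul]; ring
    have h4 : (PowerSeries.C 2 : PowerSeries ℂ) = 2 := map_ofNat _ 2
    rw [h2, h1, hE]
    rw [h4] at hode
    linear_combination PowerSeries.exp ℂ * hode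
  have := congrArg (PowerSeries.coeff (n + 1)) hode2
  simp only [map_add, map_sub, PowerSeries.coeff_C_mul, PowerSeries.coeff_succ_X_mul, D,
    PowerSeries.coeff_derivative, map_zero, hc] at this
  push_cast at this
  linear_combination this

/-- Both sides satisfy the same second-order recurrence, so the values at 0 and 1 are checked by
hand. For 1/γ_μ the recurrence reduces to (n + 2)(n + 2 + 2μ) = d_{n+2}(1 + d_{n+1}): the parity of
n only decides which factor is which. -/
theorem coeff_kummer_exp {μ : ℝ} (hμ : -(1 / 2 : ℝ) < μ) (n : ℕ) :
    PowerSeries.coeff n (PowerSeries.exp ℂ * PowerSeries.mk (kummerCoeff μ))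
      = ((genFactorial μ n : ℝ) : ℂ)⁻¹ := by
  set E := PowerSeries.exp ℂ * PowerSeries.mk (kummerCoeff μ) with hE
  have h0 : PowerSeries.coeff 0 E = 1 := by
    simp [hE, PowerSeries.coeff_mul, kummerCoeff]
  have hγ : ∀ n, ((genFactorial μ n : ℝ) : ℂ) ≠ 0 := fun n => by
    exact_mod_cast (genFactorial_pos hμ n).ne'
  have h1 : PowerSeries.coeff 1 E = ((genFactorial μ 1 : ℝ) : ℂ)⁻¹ := by
    have e : kummerCoeff μ 1 = _ := kummerCoeff_succ hμ 0
    have e0 : kummerCoeff μ 0 = 1 := by simp [kummerCoeff]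
    have hd := kummerCoeff_denom_ne hμ 0
    rw [hE, PowerSeries.coeff_mul, Finset.Nat.sum_antidiagonal_eq_sum_range_succ_mk,
      Finset.sum_range_succ, Finset.sum_range_one]
    have hg : genFactorial μ 1 = 1 + 2 * μ := by
      rw [genFactorial_succ hμ 0, genFactorial_zero hμ, zero_add, dunklCoeff_of_odd μ odd_one]
      simp
    simp only [hg, PowerSeries.coeff_exp, PowerSeries.coeff_mk]
    simp [e, e0]
    simp at hd
    have hd' : 1 + 2 * (μ : ℂ) ≠ 0 := by rwa [add_comm]
    field_simp
    ring
  induction n using Nat.strong_induction_on with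
  | _ n ih =>
    match n, ih with
    | 0, _ => rw [h0, genFactorial_zero hμ]; simp
    | 1, _ => exact h1
    | n + 2, ih =>
      have hr := kummer_exp_recurrence hμ E hE n
      rw [ih (n + 1) (by omega), ih n (by omega)] at hr
      have g1 := genFactorial_succ hμ n
      have g2 := genFactorial_succ hμ (n + 1)
      have hn2 : ((n : ℂ) + 2) ≠ 0 := by exact_mod_cast (n + 1).succ_ne_zero
      have hn3 : ((n : ℂ) + 2 + 2 * μ) ≠ 0 := by
        have := kummerCoeff_denom_ne hμ (n + 1)
        push_cast at this
        intro h
        exact this (by linear_combination h)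
      apply mul_left_cancel₀ (mul_ne_zero hn2 hn3)
      rw [hr, eq_mul_inv_iff_mul_eq₀ (hγ _), g2, add_mul]
      have k1 := hγ (n + 1)
      have k0 := hγ n
      have e1 : ((genFactorial μ (n + 1) : ℝ) : ℂ)⁻¹ * ((dunklCoeff μ (n + 1 + 1) *
          genFactorial μ (n + 1) : ℝ) : ℂ) = dunklCoeff μ (n + 1 + 1) := by
        push_cast
        field_simp
      have e2 : ((genFactorial μ n : ℝ) : ℂ)⁻¹ * ((dunklCoeff μ (n + 1 + 1) *
          genFactorial μ (n + 1) : ℝ) : ℂ) = dunklCoeff μ (n + 1 + 1) * dunklCoeff μ (n + 1) := by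
        rw [g1]
        push_cast
        field_simp
      rw [e1, e2]
      rcases Nat.even_or_odd n with h | h
      · rw [dunklCoeff_of_even μ (by simpa [Nat.even_add_one] using h),
          dunklCoeff_of_odd μ (by simpa using h.add_one)]
        push_cast
        ring
      · rw [dunklCoeff_of_odd μ (h.add_one.add_one), dunklCoeff_of_even μ h.add_one]
        push_cast
        ring

/-- The generalized exponential is `∑ zⁿ / γ_μ(n)`. -/
theorem hasSum_genExp {μ : ℝ} (hμ : -(1 / 2 : ℝ) < μ) (z : ℂ) :
    HasSum (fun n => z ^ n / (genFactorial μ n : ℂ)) (genExp μ z) := by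
  have s1 : Summable fun n : ℕ => ‖z ^ n / (n ! : ℂ)‖ := by
    simpa [norm_div, norm_pow] using Real.summable_pow_div_factorial ‖z‖
  have s2 : Summable fun n : ℕ => ‖kummerCoeff μ n * z ^ n‖ := by
    refine Summable.of_nonneg_of_le (fun _ => norm_nonneg _) (fun n => ?_)
      (Real.summable_pow_div_factorial (2 * (1 + |μ| / (2 * μ + 1)) * ‖z‖))
    rw [norm_mul, norm_pow, mul_pow, mul_div_right_comm]
    gcongr
    exact norm_kummerCoeff_le hμ n
  have hs := (summable_norm_sum_mul_antidiagonal_of_summable_norm s1 s2).of_norm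
  have ht := tsum_mul_tsum_eq_tsum_sum_antidiagonal_of_summable_norm s1 s2
  have he : ∀ n, ∑ kl ∈ Finset.HasAntidiagonal.antidiagonal n, z ^ kl.1 / (kl.1 ! : ℂ) *
      (kummerCoeff μ kl.2 * z ^ kl.2) = z ^ n / (genFactorial μ n : ℂ) := by
    intro n
    rw [div_eq_mul_inv _ ((genFactorial μ n : ℝ) : ℂ), ← coeff_kummer_exp hμ,
      PowerSeries.coeff_mul, Finset.mul_sum]
    refine Finset.sum_congr rfl fun kl hkl => ?_
    rw [← Finset.HasAntidiagonal.mem_antidiagonal.1 hkl, pow_add]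
    simp [PowerSeries.coeff_exp]
    ring
  simp_rw [he] at hs ht
  have : genExp μ z = ∑' n, z ^ n / (genFactorial μ n : ℂ) := by
    rw [← ht, genExp, kummerPhi, Complex.exp_eq_exp_ℂ, NormedSpace.exp_eq_tsum_div]
    congr 1
    refine tsum_congr fun n => ?_
    rw [kummerCoeff, mul_pow]
    ring
  rw [this]
  exact hs.hasSum

theorem norm_genExp_le {μ : ℝ} (hμ : -(1 / 2 : ℝ) < μ) (z : ℂ) :
    ‖genExp μ z‖ ≤ Real.exp ((dunklLower μ)⁻¹ * ‖z‖) := by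
  have hs : HasSum (fun n : ℕ => ((dunklLower μ)⁻¹ * ‖z‖) ^ n / n !)
      (Real.exp ((dunklLower μ)⁻¹ * ‖z‖)) := by
    rw [Real.exp_eq_exp_ℝ]
    exact NormedSpace.expSeries_div_hasSum_exp _
  rw [← (hasSum_genExp hμ z).tsum_eq, ← hs.tsum_eq]
  refine tsum_of_norm_bounded hs.summable.hasSum fun n => ?_
  rw [norm_div, norm_pow, Complex.norm_real, Real.norm_of_nonneg (genFactorial_pos hμ n).le,
    div_eq_mul_inv, mul_pow, mul_comm ((dunklLower μ)⁻¹ ^ n), mul_div_assoc]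
  gcongr
  exact inv_genFactorial_le hμ n

theorem continuous_genExp {μ : ℝ} (hμ : -(1 / 2 : ℝ) < μ) : Continuous (genExp μ) := by
  have h : genExp μ = fun z => ∑' n, z ^ n / (genFactorial μ n : ℂ) :=
    funext fun z => (hasSum_genExp hμ z).tsum_eq.symm
  rw [continuous_iff_continuousAt]
  intro z₀
  have hc : ContinuousOn (genExp μ) (Metric.ball 0 (‖z₀‖ + 1)) := by
    rw [h]
    refine continuousOn_tsum (u := fun n : ℕ => ((dunklLower μ)⁻¹ * (‖z₀‖ + 1)) ^ n / n !)
      (fun n => by fun_prop) (Real.summable_pow_div_factorial _) fun n z hz => ?_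
    rw [norm_div, norm_pow, Complex.norm_real, Real.norm_of_nonneg (genFactorial_pos hμ n).le,
      div_eq_mul_inv, mul_pow, mul_comm ((dunklLower μ)⁻¹ ^ n), mul_div_assoc]
    have hz' : ‖z‖ ≤ ‖z₀‖ + 1 := by simpa using (Metric.mem_ball.1 hz).le
    have := inv_genFactorial_le hμ n
    have := (genFactorial_pos hμ n).le
    gcongr
  exact hc.continuousAt (Metric.isOpen_ball.mem_nhds (by simp))

/-! ### The weighted measure and Gaussian integrability -/

theorem measurable_weight (μ : ℝ) :
    Measurable fun t : ℝ => ENNReal.ofReal (|t| ^ (2 * μ)) := by fun_prop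

theorem integrable_weightMeasure_iff {μ : ℝ} {f : ℝ → ℂ} :
    Integrable f (weightMeasure μ) ↔ Integrable fun t => f t * ((|t| ^ (2 * μ) : ℝ) : ℂ) := by
  rw [weightMeasure, integrable_withDensity_iff_integrable_smul' (measurable_weight μ)
    (Filter.Eventually.of_forall fun t => ENNReal.ofReal_lt_top)]
  refine integrable_congr (Filter.Eventually.of_forall fun t => ?_)
  simp only
  rw [ENNReal.toReal_ofReal (by positivity), Complex.real_smul, mul_comm]

theorem integrable_weightMeasure_real_iff {μ : ℝ} {f : ℝ → ℝ} :
    Integrable f (weightMeasure μ) ↔ Integrable fun t => f t * |t| ^ (2 * μ) := by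
  rw [weightMeasure, integrable_withDensity_iff_integrable_smul' (measurable_weight μ)
    (Filter.Eventually.of_forall fun t => ENNReal.ofReal_lt_top)]
  refine integrable_congr (Filter.Eventually.of_forall fun t => ?_)
  simp only
  rw [ENNReal.toReal_ofReal (by positivity), smul_eq_mul, mul_comm]

theorem integral_weightMeasure {μ : ℝ} (f : ℝ → ℂ) :
    ∫ t, f t ∂(weightMeasure μ) = ∫ t, f t * ((|t| ^ (2 * μ) : ℝ) : ℂ) := by
  rw [weightMeasure, integral_withDensity_eq_integral_toReal_smul (measurable_weight μ)
    (Filter.Eventually.of_forall fun t => ENNReal.ofReal_lt_top)]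
  refine integral_congr_ae (Filter.Eventually.of_forall fun t => ?_)
  simp only
  rw [ENNReal.toReal_ofReal (by positivity), Complex.real_smul, mul_comm]

theorem integral_weightMeasure_real {μ : ℝ} (f : ℝ → ℝ) :
    ∫ t, f t ∂(weightMeasure μ) = ∫ t, f t * |t| ^ (2 * μ) := by
  rw [weightMeasure, integral_withDensity_eq_integral_toReal_smul (measurable_weight μ)
    (Filter.Eventually.of_forall fun t => ENNReal.ofReal_lt_top)]
  refine integral_congr_ae (Filter.Eventually.of_forall fun t => ?_)
  simp only
  rw [ENNReal.toReal_ofReal (by positivity), smul_eq_mul, mul_comm]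

theorem integrable_of_even_of_integrableOn_Ioi {f : ℝ → ℝ} (he : ∀ x, f (-x) = f x)
    (hf : IntegrableOn f (Set.Ioi 0)) : Integrable f := by
  rw [← integrableOn_univ, ← @Set.Iio_union_Ici _ _ (0 : ℝ), integrableOn_union,
    integrableOn_Ici_iff_integrableOn_Ioi]
  refine ⟨?_, hf⟩
  rw [← (Measure.measurePreserving_neg (volume : Measure ℝ)).integrableOn_comp_preimage
      (Homeomorph.neg ℝ).measurableEmbedding]
  simpa [Function.comp_def, he] using hf

theorem integrable_abs_pow_mul_gaussian {μ a : ℝ} (hμ : -(1 / 2 : ℝ) < μ) (ha : 0 < a) (n : ℕ) :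
    Integrable (fun t : ℝ => |t| ^ n * Real.exp (-(a * t ^ 2))) (weightMeasure μ) := by
  rw [integrable_weightMeasure_real_iff]
  refine integrable_of_even_of_integrableOn_Ioi (fun x => by simp) ?_
  have hn : (0 : ℝ) ≤ n := n.cast_nonneg
  refine (integrableOn_rpow_mul_exp_neg_mul_sq ha (s := n + 2 * μ) (by linarith)).congr_fun
    (fun x hx => ?_) measurableSet_Ioi
  have hx : 0 < x := hx
  simp only [abs_of_pos hx]
  rw [Real.rpow_add hx, Real.rpow_natCast, neg_mul]
  ring

/-- Completing the square: half of the Gaussian absorbs the exponential growth of the kernel. -/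
theorem exp_abs_mul_gaussian_le {a : ℝ} (ha : 0 < a) (c t : ℝ) :
    Real.exp (c * |t|) * Real.exp (-(a * t ^ 2))
      ≤ Real.exp (c ^ 2 / (2 * a)) * Real.exp (-(a / 2 * t ^ 2)) := by
  rw [← Real.exp_add, ← Real.exp_add]
  apply Real.exp_le_exp.2
  have h : c * |t| ≤ c ^ 2 / (2 * a) + a / 2 * |t| ^ 2 := by
    have h1 := sq_nonneg (c - a * |t|)
    have h2 : c ^ 2 / (2 * a) + a / 2 * |t| ^ 2 - c * |t| = (c - a * |t|) ^ 2 / (2 * a) := by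
      field_simp; ring
    have h3 : 0 ≤ (c - a * |t|) ^ 2 / (2 * a) := by positivity
    linarith
  rw [sq_abs] at h
  linarith

theorem integrable_abs_pow_mul_exp_mul_gaussian {μ a : ℝ} (hμ : -(1 / 2 : ℝ) < μ) (ha : 0 < a)
    (c : ℝ) (n : ℕ) :
    Integrable (fun t : ℝ => |t| ^ n * (Real.exp (c * |t|) * Real.exp (-(a * t ^ 2))))
      (weightMeasure μ) := by
  refine ((integrable_abs_pow_mul_gaussian hμ (half_pos ha) n).const_mul
    (Real.exp (c ^ 2 / (2 * a)))).mono' (by fun_prop) (Filter.Eventually.of_forall fun t => ?_)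
  rw [Real.norm_of_nonneg (by positivity), mul_left_comm (Real.exp (c ^ 2 / (2 * a)))]
  exact mul_le_mul_of_nonneg_left (exp_abs_mul_gaussian_le ha c t) (by positivity)

theorem integrable_pow_mul_gaussian {μ a : ℝ} (hμ : -(1 / 2 : ℝ) < μ) (ha : 0 < a) (n : ℕ) :
    Integrable (fun t : ℝ => t ^ n * Real.exp (-(a * t ^ 2))) (weightMeasure μ) := by
  refine (integrable_abs_pow_mul_gaussian hμ ha n).mono' (by fun_prop)
    (Filter.Eventually.of_forall fun t => le_of_eq ?_)
  rw [norm_mul, norm_pow, Real.norm_eq_abs, Real.norm_of_nonneg (Real.exp_pos _).le]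

/-! ### Moments -/

/-- The moments `∫ tⁿ exp(-a t²) |t|^(2μ) dt`. -/
noncomputable def gaussMoment (μ a : ℝ) (n : ℕ) : ℝ :=
  ∫ t, t ^ n * Real.exp (-(a * t ^ 2)) ∂(weightMeasure μ)

theorem gaussMoment_of_odd (μ a : ℝ) {n : ℕ} (hn : Odd n) : gaussMoment μ a n = 0 := by
  rw [gaussMoment, integral_weightMeasure_real]
  have h := integral_neg_eq_self
    (fun t : ℝ => t ^ n * Real.exp (-(a * t ^ 2)) * |t| ^ (2 * μ)) volume
  have e : ∀ t : ℝ, (-t) ^ n * Real.exp (-(a * (-t) ^ 2)) * |-t| ^ (2 * μ)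
      = -(t ^ n * Real.exp (-(a * t ^ 2)) * |t| ^ (2 * μ)) := fun t => by
    rw [hn.neg_pow, neg_sq, abs_neg]; ring
  simp_rw [e, integral_neg] at h
  linarith

theorem gaussMoment_of_even {μ a : ℝ} (hμ : -(1 / 2 : ℝ) < μ) (ha : 0 < a) {n : ℕ}
    (hn : Even n) :
    gaussMoment μ a n = a ^ (-(n + 2 * μ + 1) / 2) * Real.Gamma ((n + 2 * μ + 1) / 2) := by
  rw [gaussMoment, integral_weightMeasure_real]
  have e : ∀ t : ℝ, t ^ n * Real.exp (-(a * t ^ 2)) * |t| ^ (2 * μ)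
      = |t| ^ n * Real.exp (-(a * |t| ^ 2)) * |t| ^ (2 * μ) := fun t => by
    rw [hn.pow_abs, sq_abs]
  simp_rw [e]
  rw [integral_comp_abs (f := fun t => t ^ n * Real.exp (-(a * t ^ 2)) * t ^ (2 * μ))]
  have hn0 : (0 : ℝ) ≤ n := n.cast_nonneg
  have h := integral_rpow_mul_exp_neg_mul_rpow (p := 2) (q := n + 2 * μ) two_pos
    (by linarith) ha
  have e2 : ∫ x in Set.Ioi (0 : ℝ), x ^ n * Real.exp (-(a * x ^ 2)) * x ^ (2 * μ)
      = ∫ x in Set.Ioi (0 : ℝ), x ^ ((n : ℝ) + 2 * μ) * Real.exp (-a * x ^ (2 : ℝ)) := by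
    refine setIntegral_congr_fun measurableSet_Ioi fun x hx => ?_
    have hx : 0 < x := hx
    rw [Real.rpow_add hx, Real.rpow_natCast, neg_mul, Real.rpow_two]
    ring
  rw [e2, h]
  ring

theorem gaussMoment_zero {μ a : ℝ} (hμ : -(1 / 2 : ℝ) < μ) (ha : 0 < a) :
    gaussMoment μ a 0 = a ^ (-(μ + 1 / 2)) * Real.Gamma (μ + 1 / 2) := by
  rw [gaussMoment_of_even hμ ha Even.zero]
  congr 2 <;> (push_cast; ring)

/-- For even n this is Γ(s + 1) = sΓ(s) with 2s = n + 2μ + 1 = d_{n+1}. It expresses the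
antisymmetry of the Dunkl operator on the monomial tⁿ⁺¹ paired with 1. -/
theorem gaussMoment_add_two {μ a : ℝ} (hμ : -(1 / 2 : ℝ) < μ) (ha : 0 < a) (n : ℕ) :
    2 * a * gaussMoment μ a (n + 2) = dunklCoeff μ (n + 1) * gaussMoment μ a n := by
  rcases Nat.even_or_odd n with h | h
  · rw [gaussMoment_of_even hμ ha h, gaussMoment_of_even hμ ha (h.add even_two),
      dunklCoeff_of_odd μ h.add_one]
    have hn0 : (0 : ℝ) ≤ n := n.cast_nonneg
    have hp : 0 < ((n : ℝ) + 2 * μ + 1) / 2 := by linarith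
    have e1 : (((n + 2 : ℕ) : ℝ) + 2 * μ + 1) / 2 = (n + 2 * μ + 1) / 2 + 1 := by
      push_cast; ring
    have e2 : -(((n + 2 : ℕ) : ℝ) + 2 * μ + 1) / 2 = -(n + 2 * μ + 1) / 2 - 1 := by
      push_cast; ring
    rw [e1, e2, Real.Gamma_add_one hp.ne', Real.rpow_sub_one ha.ne']
    field_simp
    push_cast
    ring
  · rw [gaussMoment_of_odd μ a h, gaussMoment_of_odd μ a (h.add_even even_two)]
    simp

/-- The quotient of the moment by γ_μ(2j) is, up to a constant, 1/(2ʲ j!), the modulus of a Taylor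
coefficient of exp(-x²/2). This makes the Gaussian an eigenfunction. -/
theorem gaussMoment_half_two_mul {μ : ℝ} (hμ : -(1 / 2 : ℝ) < μ) (j : ℕ) :
    gaussMoment μ (1 / 2) (2 * j)
      = gaussMoment μ (1 / 2) 0 * genFactorial μ (2 * j) / (2 ^ j * j !) := by
  induction j with
  | zero => simp [genFactorial_zero hμ]
  | succ j ih =>
    have h := gaussMoment_add_two hμ (a := 1 / 2) (by norm_num) (2 * j)
    rw [show 2 * (j + 1) = 2 * j + 1 + 1 by ring, genFactorial_succ hμ, genFactorial_succ hμ,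
      dunklCoeff_of_even μ (n := 2 * j + 1 + 1) ⟨j + 1, by ring⟩]
    have h' : gaussMoment μ (1 / 2) (2 * j + 1 + 1)
      = dunklCoeff μ (2 * j + 1) * gaussMoment μ (1 / 2) (2 * j) := by
      rw [← h]; ring_nf
    rw [h', ih, Nat.factorial_succ]
    push_cast
    field_simp
    ring

theorem memLp_abs_pow_mul_exp_mul_gaussian {μ a : ℝ} (hμ : -(1 / 2 : ℝ) < μ) (ha : 0 < a)
    (c : ℝ) (n : ℕ) :
    MemLp (fun t : ℝ => |t| ^ n * (Real.exp (c * |t|) * Real.exp (-(a * t ^ 2)))) 2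
      (weightMeasure μ) := by
  rw [memLp_two_iff_integrable_sq (by fun_prop)]
  refine (integrable_abs_pow_mul_exp_mul_gaussian hμ (a := 2 * a) (by positivity) (2 * c)
    (2 * n)).congr (Filter.Eventually.of_forall fun t => ?_)
  simp only
  rw [mul_pow, mul_pow, ← Real.exp_nat_mul, ← Real.exp_nat_mul, ← pow_mul, mul_comm n 2]
  congr 3 <;> (push_cast; ring)

theorem memLp_pow_mul_gaussian {μ a : ℝ} (hμ : -(1 / 2 : ℝ) < μ) (ha : 0 < a) (n : ℕ) :
    MemLp (fun t : ℝ => Real.exp (-(a * t ^ 2)) * t ^ n) 2 (weightMeasure μ) := by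
  refine (memLp_abs_pow_mul_exp_mul_gaussian hμ ha 0 n).of_le (by fun_prop)
    (Filter.Eventually.of_forall fun t => ?_)
  simp [mul_comm]

/-! ### Completeness of Gaussian monomials -/

/-- A real integrable function whose Fourier transform vanishes is zero. -/
theorem ae_eq_zero_of_forall_integral_cexp_eq_zero {ν : Measure ℝ} {g : ℝ → ℝ}
    (hg : Integrable g ν) (h : ∀ x : ℝ, ∫ t, Complex.exp (x * t * Complex.I) * g t ∂ν = 0) :
    g =ᵐ[ν] 0 := by
  have hfin : ∀ f : ℝ → ℝ, Integrable f ν → ∫⁻ t, ENNReal.ofReal (f t) ∂ν ≠ ∞ := fun f hf =>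
    hf.lintegral_lt_top.ne
  have key : ∀ f : ℝ → ℝ, Integrable f ν → ∀ x, charFun (ν.withDensity fun t =>
      ENNReal.ofReal (f t)) x = ∫ t, Complex.exp (x * t * Complex.I) * (max (f t) 0 : ℝ) ∂ν := by
    intro f hf x
    rw [charFun_apply_real, integral_withDensity_eq_integral_toReal_smul₀
      hf.aestronglyMeasurable.aemeasurable.ennreal_ofReal
      (Filter.Eventually.of_forall fun t => ENNReal.ofReal_lt_top)]
    refine integral_congr_ae (Filter.Eventually.of_forall fun t => ?_)
    simp only
    rw [ENNReal.toReal_ofReal', Complex.real_smul, mul_comm]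
  have hint : ∀ f : ℝ → ℝ, Integrable f ν → ∀ x : ℝ,
      Integrable (fun t : ℝ => Complex.exp (x * t * Complex.I) * (f t : ℂ)) ν := by
    intro f hf x
    refine hf.norm.mono' ((by fun_prop : Continuous fun t : ℝ =>
      Complex.exp (x * t * Complex.I)).aestronglyMeasurable.mul
      (hf.ofReal (𝕜 := ℂ)).aestronglyMeasurable) (Filter.Eventually.of_forall fun t => ?_)
    rw [norm_mul, ← Complex.ofReal_mul, Complex.norm_exp_ofReal_mul_I, one_mul, Complex.norm_real]
  have := isFiniteMeasure_withDensity (hfin g hg)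
  have := isFiniteMeasure_withDensity (hfin _ hg.neg)
  -- The positive and negative parts of g are densities of two finite measures with equal
  -- characteristic functions, hence of the same measure.
  have heq : ν.withDensity (fun t => ENNReal.ofReal (g t))
      = ν.withDensity (fun t => ENNReal.ofReal ((-g) t)) := by
    apply Measure.ext_of_charFun
    funext x
    rw [key g hg, key _ hg.neg, ← sub_eq_zero, ← integral_sub (hint _ hg.pos_part x)
      (hint _ hg.neg.pos_part x), ← h x]
    refine integral_congr_ae (Filter.Eventually.of_forall fun t => ?_)
    simp only [Pi.neg_apply]
    rw [← mul_sub, ← Complex.ofReal_sub]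
    congr 2
    rcases le_total (g t) 0 with h0 | h0
    · rw [max_eq_right h0, max_eq_left (by linarith)]; ring
    · rw [max_eq_left h0, max_eq_right (by linarith)]; ring
  rw [withDensity_eq_iff hg.aestronglyMeasurable.aemeasurable.ennreal_ofReal
    hg.neg.aestronglyMeasurable.aemeasurable.ennreal_ofReal (hfin g hg)] at heq
  filter_upwards [heq] with t ht
  simp only [Pi.neg_apply] at ht
  rcases le_total (g t) 0 with h0 | h0
  · rw [ENNReal.ofReal_of_nonpos h0] at ht
    have := ENNReal.ofReal_eq_zero.1 ht.symm
    simp only [Pi.zero_apply]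
    linarith
  · rw [ENNReal.ofReal_of_nonpos (by linarith : -g t ≤ 0)] at ht
    have := ENNReal.ofReal_eq_zero.1 ht
    simp only [Pi.zero_apply]
    linarith

/-- Expanding exp(ixt) writes the Fourier transform of exp(-at²) v as a series in the vanishing
moments. Integration term by term is dominated by exp(|x||t|) exp(-at²) |v|, which is integrable as
a product of two L² functions. -/
theorem ae_eq_zero_of_forall_integral_pow_mul_gaussian_real {μ a : ℝ} (hμ : -(1 / 2 : ℝ) < μ)
    (ha : 0 < a) {v : ℝ → ℝ} (hv : MemLp v 2 (weightMeasure μ))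
    (h : ∀ n : ℕ, ∫ t, Real.exp (-(a * t ^ 2)) * t ^ n * v t ∂(weightMeasure μ) = 0) :
    v =ᵐ[weightMeasure μ] 0 := by
  have hint : ∀ c : ℝ, Integrable (fun t => Real.exp (c * |t|) * Real.exp (-(a * t ^ 2)) * v t)
      (weightMeasure μ) := fun c => by
    refine ((memLp_abs_pow_mul_exp_mul_gaussian hμ ha c 0).integrable_mul hv).congr
      (Filter.Eventually.of_forall fun t => by simp)
  have hg : Integrable (fun t => Real.exp (-(a * t ^ 2)) * v t) (weightMeasure μ) := by
    simpa using hint 0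
  have hz := ae_eq_zero_of_forall_integral_cexp_eq_zero hg fun x => by
    have hs := hasSum_integral_of_dominated_convergence (μ := weightMeasure μ)
      (F := fun (n : ℕ) (t : ℝ) => (x * t * Complex.I) ^ n / (n ! : ℂ) *
        ((Real.exp (-(a * t ^ 2)) * v t : ℝ) : ℂ))
      (f := fun t => Complex.exp (x * t * Complex.I) * ((Real.exp (-(a * t ^ 2)) * v t : ℝ) : ℂ))
      (fun n t => (|x| * |t|) ^ n / n ! * |Real.exp (-(a * t ^ 2)) * v t|)
      (fun n => (by fun_prop : Continuous fun t : ℝ =>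
        (x * t * Complex.I) ^ n / (n ! : ℂ)).aestronglyMeasurable.mul
          (hg.ofReal (𝕜 := ℂ)).aestronglyMeasurable)
      (fun n => Filter.Eventually.of_forall fun t => by
        simp only [norm_mul, norm_div, norm_pow, Complex.norm_real, Complex.norm_I, mul_one,
          Complex.norm_natCast, Real.norm_eq_abs, abs_mul, le_refl])
      (Filter.Eventually.of_forall fun t => (Real.summable_pow_div_factorial _).mul_right _)
      (by
        refine (hint |x|).norm.congr (Filter.Eventually.of_forall fun t => ?_)
        simp only
        rw [tsum_mul_right, Real.norm_eq_abs, mul_assoc, abs_mul (Real.exp (|x| * |t|)),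
          abs_of_pos (Real.exp_pos _), Real.exp_eq_exp_ℝ, NormedSpace.exp_eq_tsum_div])
      (Filter.Eventually.of_forall fun t => by
        refine HasSum.mul_right _ ?_
        rw [Complex.exp_eq_exp_ℂ]
        exact NormedSpace.expSeries_div_hasSum_exp _)
    rw [← hs.tsum_eq]
    refine (tsum_congr fun n => ?_).trans tsum_zero
    have e : ∀ t : ℝ, (x * t * Complex.I) ^ n / (n ! : ℂ) *
        ((Real.exp (-(a * t ^ 2)) * v t : ℝ) : ℂ) = ((x * Complex.I) ^ n / (n ! : ℂ)) *
        ((Real.exp (-(a * t ^ 2)) * t ^ n * v t : ℝ) : ℂ) := fun t => by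
      push_cast
      rw [mul_right_comm (x : ℂ), mul_pow _ (t : ℂ)]
      ring
    simp_rw [e]
    rw [integral_const_mul, integral_complex_ofReal, h n]
    simp
  filter_upwards [hz] with t ht
  exact (mul_eq_zero.1 ht).resolve_left (Real.exp_pos _).ne'

/-- Completeness of the functions `exp(-a t²) tⁿ`. -/
theorem ae_eq_zero_of_forall_integral_pow_mul_gaussian {μ a : ℝ} (hμ : -(1 / 2 : ℝ) < μ)
    (ha : 0 < a) {v : ℝ → ℂ} (hv : MemLp v 2 (weightMeasure μ))
    (h : ∀ n : ℕ, ∫ t, ((Real.exp (-(a * t ^ 2)) * t ^ n : ℝ) : ℂ) * v t ∂(weightMeasure μ) = 0) :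
    v =ᵐ[weightMeasure μ] 0 := by
  have hint : ∀ n : ℕ, Integrable (fun t => ((Real.exp (-(a * t ^ 2)) * t ^ n : ℝ) : ℂ) * v t)
      (weightMeasure μ) := fun n =>
    (memLp_pow_mul_gaussian hμ ha n).ofReal (K := ℂ) |>.integrable_mul hv
  have h1 := ae_eq_zero_of_forall_integral_pow_mul_gaussian_real hμ ha hv.re fun n => by
    have := congrArg Complex.re (h n)
    rw [← RCLike.re_eq_complex_re, ← integral_re (hint n)] at this
    simpa only [RCLike.re_eq_complex_re, Complex.re_ofReal_mul, Complex.zero_re] using this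
  have h2 := ae_eq_zero_of_forall_integral_pow_mul_gaussian_real hμ ha hv.im fun n => by
    have := congrArg Complex.im (h n)
    rw [← RCLike.im_eq_complex_im, ← integral_im (hint n)] at this
    simpa only [RCLike.im_eq_complex_im, Complex.im_ofReal_mul, Complex.zero_im] using this
  filter_upwards [h1, h2] with t ht1 ht2
  exact Complex.ext ht1 ht2

/-! ### The Dunkl operator and Gaussian integrals of polynomials -/

/-- The Dunkl operator on polynomials, `Xⁿ ↦ dunklCoeff μ n • Xⁿ⁻¹`. -/
noncomputable def dunklOp (μ : ℝ) : Polynomial ℂ →ₗ[ℂ] Polynomial ℂ :=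
  (Polynomial.basisMonomials ℂ).constr ℂ fun n =>
    Polynomial.monomial (n - 1) ((dunklCoeff μ n : ℝ) : ℂ)

theorem dunklOp_monomial (μ : ℝ) (n : ℕ) (c : ℂ) :
    dunklOp μ (Polynomial.monomial n c)
      = Polynomial.monomial (n - 1) (c * (dunklCoeff μ n : ℝ)) := by
  have h := (Polynomial.basisMonomials ℂ).constr_basis ℂ (fun n =>
    Polynomial.monomial (n - 1) ((dunklCoeff μ n : ℝ) : ℂ)) n
  rw [Polynomial.coe_basisMonomials] at h
  have e : Polynomial.monomial n c = c • Polynomial.monomial n (1 : ℂ) := by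
    simp [Polynomial.smul_monomial]
  rw [e, map_smul, dunklOp, h, Polynomial.smul_monomial, smul_eq_mul]

theorem coeff_dunklOp (μ : ℝ) (p : Polynomial ℂ) (k : ℕ) :
    (dunklOp μ p).coeff k = (dunklCoeff μ (k + 1) : ℝ) * p.coeff (k + 1) := by
  induction p using Polynomial.induction_on' with
  | add p q hp hq => simp only [map_add, Polynomial.coeff_add, hp, hq]; ring
  | monomial n c =>
    rw [dunklOp_monomial, Polynomial.coeff_monomial, Polynomial.coeff_monomial]
    rcases n with _ | n
    · simp [dunklCoeff_zero]
    · by_cases h : n = k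
      · simp [h, mul_comm]
      · simp [h]

theorem coeff_dunklOp_iterate {μ : ℝ} (hμ : -(1 / 2 : ℝ) < μ) (m : ℕ) (p : Polynomial ℂ)
    (k : ℕ) :
    ((dunklOp μ)^[m] p).coeff k
      = ((genFactorial μ (k + m) : ℝ) : ℂ) / (genFactorial μ k : ℝ) * p.coeff (k + m) := by
  have hγ : ∀ n, ((genFactorial μ n : ℝ) : ℂ) ≠ 0 := fun n => by
    exact_mod_cast (genFactorial_pos hμ n).ne'
  induction m generalizing k with
  | zero => simp [hγ]
  | succ m ih =>
    rw [Function.iterate_succ_apply', coeff_dunklOp, ih, genFactorial_succ hμ k,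
      show k + 1 + m = k + (m + 1) by ring]
    have h1 : ((dunklCoeff μ (k + 1) : ℝ) : ℂ) ≠ 0 := by
      exact_mod_cast (dunklCoeff_pos hμ k.succ_pos).ne'
    have := hγ k
    push_cast
    field_simp

/-- Integration of polynomials against `exp(-a t²) |t|^(2μ) dt`. -/
noncomputable def gaussIntegral (μ a : ℝ) : Polynomial ℂ →ₗ[ℂ] ℂ :=
  (Polynomial.basisMonomials ℂ).constr ℂ fun n => ((gaussMoment μ a n : ℝ) : ℂ)

theorem gaussIntegral_monomial (μ a : ℝ) (n : ℕ) (c : ℂ) :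
    gaussIntegral μ a (Polynomial.monomial n c) = c * (gaussMoment μ a n : ℝ) := by
  have h := (Polynomial.basisMonomials ℂ).constr_basis ℂ
    (fun n => ((gaussMoment μ a n : ℝ) : ℂ)) n
  rw [Polynomial.coe_basisMonomials] at h
  have e : Polynomial.monomial n c = c • Polynomial.monomial n (1 : ℂ) := by
    simp [Polynomial.smul_monomial]
  rw [e, map_smul, gaussIntegral, h, smul_eq_mul]

theorem integrable_polynomial_mul_gaussian {μ a : ℝ} (hμ : -(1 / 2 : ℝ) < μ) (ha : 0 < a)
    (p : Polynomial ℂ) :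
    Integrable (fun t : ℝ => p.eval (t : ℂ) * (Real.exp (-(a * t ^ 2)) : ℝ))
      (weightMeasure μ) := by
  induction p using Polynomial.induction_on' with
  | add p q hp hq =>
    simp only [Polynomial.eval_add, add_mul]
    exact hp.add hq
  | monomial n c =>
    refine (((integrable_pow_mul_gaussian hμ ha n).ofReal (𝕜 := ℂ)).const_mul c).congr
      (Filter.Eventually.of_forall fun t => ?_)
    change c * ((t ^ n * Real.exp (-(a * t ^ 2)) : ℝ) : ℂ) = _
    simp only [Polynomial.eval_monomial]
    push_cast
    ring

theorem gaussIntegral_eq_integral {μ a : ℝ} (hμ : -(1 / 2 : ℝ) < μ) (ha : 0 < a)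
    (p : Polynomial ℂ) :
    gaussIntegral μ a p
      = ∫ t : ℝ, p.eval (t : ℂ) * (Real.exp (-(a * t ^ 2)) : ℝ) ∂(weightMeasure μ) := by
  induction p using Polynomial.induction_on' with
  | add p q hp hq =>
    simp only [Polynomial.eval_add, add_mul]
    rw [integral_add (integrable_polynomial_mul_gaussian hμ ha p)
      (integrable_polynomial_mul_gaussian hμ ha q), map_add, hp, hq]
  | monomial n c =>
    rw [gaussIntegral_monomial, gaussMoment, ← integral_complex_ofReal, ← integral_const_mul]
    refine integral_congr_ae (Filter.Eventually.of_forall fun t => ?_)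
    simp only [Polynomial.eval_monomial]
    push_cast
    ring

/-- The Dunkl operator is antisymmetric up to the logarithmic derivative of the Gaussian. -/
theorem gaussIntegral_dunklOp_mul {μ a : ℝ} (hμ : -(1 / 2 : ℝ) < μ) (ha : 0 < a)
    (p q : Polynomial ℂ) :
    gaussIntegral μ a (dunklOp μ p * q) + gaussIntegral μ a (p * dunklOp μ q)
      = 2 * a * gaussIntegral μ a (Polynomial.X * p * q) := by
  induction p using Polynomial.induction_on' with
  | add p p' hp hp' =>
    simp only [map_add, add_mul, mul_add]
    linear_combination hp + hp'
  | monomial n c =>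
    induction q using Polynomial.induction_on' with
    | add q q' hq hq' =>
      simp only [map_add, mul_add]
      linear_combination hq + hq'
    | monomial m c' =>
      rw [dunklOp_monomial, dunklOp_monomial, Polynomial.X_mul_monomial,
        Polynomial.monomial_mul_monomial, Polynomial.monomial_mul_monomial,
        Polynomial.monomial_mul_monomial, gaussIntegral_monomial, gaussIntegral_monomial,
        gaussIntegral_monomial]
      -- For n + m even all the moments have odd index and vanish. The exponents n - 1 and m - 1 are
      -- truncated at zero, but there the coefficient d_0 = 0 kills the term.
      rcases Nat.even_or_odd (n + m) with h | h
      · have h1 : gaussMoment μ a (n + 1 + m) = 0 :=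
          gaussMoment_of_odd μ a (by rw [add_right_comm]; exact h.add_one)
        have h2 : n = 0 ∨ gaussMoment μ a (n - 1 + m) = 0 := by
          rcases n with _ | n
          · exact Or.inl rfl
          · right
            apply gaussMoment_of_odd
            rw [← Nat.not_even_iff_odd]
            intro h'
            rw [Nat.add_right_comm, Nat.even_add_one] at h
            exact h (by simpa using h')
        have h3 : m = 0 ∨ gaussMoment μ a (n + (m - 1)) = 0 := by
          rcases m with _ | m
          · exact Or.inl rfl
          · right
            apply gaussMoment_of_odd
            rw [← Nat.not_even_iff_odd]
            intro h'
            rw [← add_assoc, Nat.even_add_one] at h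
            exact h (by simpa using h')
        rw [h1]
        rcases h2 with rfl | h2 <;> rcases h3 with rfl | h3 <;>
          simp_all [dunklCoeff_zero]
      · obtain ⟨k, hk⟩ : ∃ k, n + m = k + 1 := ⟨n + m - 1, by have := h.pos; omega⟩
        have hM := gaussMoment_add_two hμ ha k
        -- The Leibniz rule for D holds on monomials as soon as one exponent is even, which is
        -- forced here by n + m being odd.
        have hd : dunklCoeff μ (k + 1) = dunklCoeff μ n + dunklCoeff μ m := by
          rw [← hk]
          rcases Nat.even_or_odd m with hm | hm
          · rw [dunklCoeff_add_even μ hm, dunklCoeff_of_even μ hm]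
          · have hn : Even n := by
              rcases Nat.even_or_odd n with hn | hn
              · exact hn
              · exact absurd (hn.add_odd hm) (Nat.not_even_iff_odd.2 h)
            rw [add_comm n, dunklCoeff_add_even μ hn, dunklCoeff_of_even μ hn, add_comm]
        have h2 : dunklCoeff μ n * gaussMoment μ a (n - 1 + m)
            = dunklCoeff μ n * gaussMoment μ a k := by
          rcases n with _ | n
          · simp [dunklCoeff_zero]
          · congr 2; omega
        have h3 : dunklCoeff μ m * gaussMoment μ a (n + (m - 1))
            = dunklCoeff μ m * gaussMoment μ a k := by
          rcases m with _ | m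
          · simp [dunklCoeff_zero]
          · congr 2; omega
        rw [show n + 1 + m = k + 2 by omega]
        rw [hd] at hM
        have h2' := congrArg (fun r : ℝ => (r : ℂ)) h2
        have h3' := congrArg (fun r : ℝ => (r : ℂ)) h3
        have hM' := congrArg (fun r : ℝ => (r : ℂ)) hM
        push_cast at h2' h3' hM'
        linear_combination (c * c') * (h2' + h3' - hM')

/-! ### Generalized Hermite polynomials -/

/-- The generalized Hermite polynomials with leading coefficient `2ⁿ`, built by the creation
operator `2X - D`. -/
noncomputable def hermitePoly (μ : ℝ) : ℕ → Polynomial ℂ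
  | 0 => 1
  | n + 1 => Polynomial.C 2 * (Polynomial.X * hermitePoly μ n) - dunklOp μ (hermitePoly μ n)

theorem coeff_hermitePoly_eq_zero (μ : ℝ) (n j : ℕ) (h : n < j ∨ Odd (n + j)) :
    (hermitePoly μ n).coeff j = 0 := by
  induction n generalizing j with
  | zero =>
    have : j ≠ 0 := by
      rintro rfl
      rcases h with h | h
      · exact absurd h (lt_irrefl _)
      · exact absurd h (by decide)
    simp [hermitePoly, Polynomial.coeff_one, this]
  | succ n ih =>
    rw [hermitePoly, Polynomial.coeff_sub, Polynomial.coeff_C_mul, coeff_dunklOp,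
      ih (j + 1) (h.imp (fun h => by omega) fun h => by
        rwa [show n + (j + 1) = n + 1 + j by ring])]
    rcases j with _ | j
    · simp
    · rw [Polynomial.coeff_X_mul, ih j (h.imp (fun h => by omega) fun h => by
        rw [show n + 1 + (j + 1) = n + j + 2 by ring] at h
        simpa [Nat.odd_add] using h)]
      simp

theorem coeff_hermitePoly {μ : ℝ} (hμ : -(1 / 2 : ℝ) < μ) (n i j : ℕ) (h : j + 2 * i = n) :
    (hermitePoly μ n).coeff j
      = (((-1) ^ i * 2 ^ j * genFactorial μ n / (i ! * genFactorial μ j) : ℝ) : ℂ) := by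
  have hγ : ∀ n, ((genFactorial μ n : ℝ) : ℂ) ≠ 0 := fun n => by
    exact_mod_cast (genFactorial_pos hμ n).ne'
  have hf : ∀ i : ℕ, (i ! : ℂ) ≠ 0 := fun i => by exact_mod_cast i.factorial_ne_zero
  have hdc : ∀ i, ((dunklCoeff μ (i + 1) : ℝ) : ℂ) ≠ 0 := fun i => by
    exact_mod_cast (dunklCoeff_pos hμ i.succ_pos).ne'
  induction n generalizing i j with
  | zero =>
    obtain rfl : j = 0 := by omega
    obtain rfl : i = 0 := by omega
    simp [hermitePoly, hγ]
  | succ n ih =>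
    rw [hermitePoly, Polynomial.coeff_sub, Polynomial.coeff_C_mul, coeff_dunklOp]
    -- The splitting d_{n+1} = d_j + 2i matches the two terms of the creation operator: 2X
    -- contributes d_j and -D contributes 2i.
    have hd : ((dunklCoeff μ (n + 1) : ℝ) : ℂ) = (dunklCoeff μ j : ℝ) + 2 * i := by
      rw [← h, dunklCoeff_add_even μ (even_two_mul i)]
      push_cast
      ring
    -- Writing 1/(i - 1)! as i/i! lets the formula include i = 0, where the coefficient lies above
    -- the degree.
    have hsecond : ((dunklCoeff μ (j + 1) : ℝ) : ℂ) * (hermitePoly μ n).coeff (j + 1)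
        = -((-1) ^ i * 2 ^ (j + 1) * i * genFactorial μ n / (i ! * genFactorial μ j)) := by
      rcases i with _ | i
      · rw [coeff_hermitePoly_eq_zero μ n (j + 1) (Or.inl (by omega))]
        simp
      · rw [ih i (j + 1) (by omega), genFactorial_succ hμ j, Nat.factorial_succ]
        have h1 := hγ j
        have h2 := hf i
        have h3 := hdc j
        have h4 : ((i : ℂ) + 1) ≠ 0 := by exact_mod_cast i.succ_ne_zero
        push_cast
        field_simp
        ring
    rw [hsecond, genFactorial_succ hμ n]
    have h1 := hf i
    rcases j with _ | j
    · rw [Polynomial.coeff_X_mul_zero]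
      have h2 := hγ 0
      rw [dunklCoeff_zero] at hd
      push_cast
      rw [hd]
      push_cast
      field_simp
      ring
    · rw [Polynomial.coeff_X_mul, ih i j (by omega), genFactorial_succ hμ j]
      have h2 := hγ j
      have h3 := hdc j
      push_cast
      rw [hd]
      field_simp
      ring

theorem coeff_hermitePoly_self {μ : ℝ} (hμ : -(1 / 2 : ℝ) < μ) (n : ℕ) :
    (hermitePoly μ n).coeff n = 2 ^ n := by
  rw [coeff_hermitePoly hμ n 0 n (by ring)]
  have := (genFactorial_pos hμ n).ne'
  simp [this]

/-- For the weight exp(-t²)|t|^(2μ) the adjoint of 2X - D is D, so the n creation operators that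
build H_n move over to p. Orthogonality follows because Dⁿ kills degrees below n, and the norm
because Dⁿ H_n is a constant. -/
theorem gaussIntegral_hermitePoly_mul {μ : ℝ} (hμ : -(1 / 2 : ℝ) < μ) (n : ℕ)
    (p : Polynomial ℂ) :
    gaussIntegral μ 1 (hermitePoly μ n * p) = gaussIntegral μ 1 ((dunklOp μ)^[n] p) := by
  induction n generalizing p with
  | zero => simp [hermitePoly]
  | succ n ih =>
    rw [Function.iterate_succ_apply, ← ih]
    have h := gaussIntegral_dunklOp_mul hμ one_pos (hermitePoly μ n) p
    have e : gaussIntegral μ 1 (hermitePoly μ (n + 1) * p)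
        = 2 * gaussIntegral μ 1 (Polynomial.X * hermitePoly μ n * p)
          - gaussIntegral μ 1 (dunklOp μ (hermitePoly μ n) * p) := by
      rw [hermitePoly, sub_mul, map_sub, mul_assoc (Polynomial.C 2), ← Polynomial.smul_eq_C_mul,
        map_smul, smul_eq_mul]
    rw [e]
    push_cast at h
    linear_combination -h

theorem gaussIntegral_hermitePoly_mul_of_lt {μ : ℝ} (hμ : -(1 / 2 : ℝ) < μ) {m n : ℕ}
    (h : m < n) : gaussIntegral μ 1 (hermitePoly μ n * hermitePoly μ m) = 0 := by
  rw [gaussIntegral_hermitePoly_mul hμ]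
  have : (dunklOp μ)^[n] (hermitePoly μ m) = 0 := by
    ext k
    rw [coeff_dunklOp_iterate hμ, coeff_hermitePoly_eq_zero μ m _ (Or.inl (by omega))]
    simp
  rw [this, map_zero]

theorem gaussIntegral_hermitePoly_sq {μ : ℝ} (hμ : -(1 / 2 : ℝ) < μ) (n : ℕ) :
    gaussIntegral μ 1 (hermitePoly μ n * hermitePoly μ n)
      = ((2 ^ n * genFactorial μ n * Real.Gamma (μ + 1 / 2) : ℝ) : ℂ) := by
  rw [gaussIntegral_hermitePoly_mul hμ]
  have : (dunklOp μ)^[n] (hermitePoly μ n)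
      = Polynomial.monomial 0 (((2 ^ n * genFactorial μ n : ℝ)) : ℂ) := by
    ext k
    rw [coeff_dunklOp_iterate hμ, Polynomial.coeff_monomial]
    rcases k with _ | k
    · rw [zero_add, coeff_hermitePoly_self hμ, genFactorial_zero hμ]
      simp [mul_comm]
    · rw [coeff_hermitePoly_eq_zero μ n _ (Or.inl (by omega))]
      simp
  rw [this, gaussIntegral_monomial, gaussMoment_zero hμ one_pos, Real.one_rpow]
  push_cast
  ring

/-- The factor γ_μ(n)/n! converts the normalization of `genHermite` into leading coefficient 2ⁿ. -/
theorem hermitePoly_two_mul {μ : ℝ} (hμ : -(1 / 2 : ℝ) < μ) (m : ℕ) :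
    hermitePoly μ (2 * m) = ∑ k ∈ Finset.range (m + 1), Polynomial.monomial (2 * k)
      ((genFactorial μ (2 * m) / (2 * m)! * ((-1) ^ m * ((2 * m)! / m !) * ((-1) ^ k * m.choose k *
        (Real.Gamma (μ + 1 / 2) / Real.Gamma (k + μ + 1 / 2)))) : ℝ) : ℂ) := by
  ext j
  rw [Polynomial.finsetSum_coeff]
  simp only [Polynomial.coeff_monomial]
  rcases Nat.even_or_odd' j with ⟨l, rfl | rfl⟩
  · simp only [mul_right_inj' (two_ne_zero' ℕ)]
    rw [Finset.sum_ite_eq']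
    by_cases hl : l ≤ m
    · obtain ⟨i, rfl⟩ := Nat.exists_eq_add_of_le hl
      rw [if_pos (by simp), coeff_hermitePoly hμ _ i (2 * l) (by ring)]
      congr 1
      have hG := (gamma_half_pos hμ).ne'
      have hG2 : Real.Gamma ((l : ℝ) + μ + 1 / 2) ≠ 0 :=
        (Real.Gamma_pos_of_pos (by have : (0 : ℝ) ≤ l := l.cast_nonneg
                                   linarith)).ne'
      have e : genFactorial μ (2 * l)
          = 2 ^ (2 * l) * l ! * Real.Gamma (l + μ + 1 / 2) / Real.Gamma (μ + 1 / 2) := by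
        simp [genFactorial]
      have hch : (((l + i).choose l : ℕ) : ℝ) = (l + i)! / (l ! * i !) := by
        rw [Nat.cast_choose ℝ (Nat.le_add_right l i), Nat.add_sub_cancel_left]
      have hs : ((-1 : ℝ) ^ l) * (-1) ^ l = 1 := by rw [← mul_pow]; simp
      rw [e, hch, pow_add (-1 : ℝ) l i]
      generalize Real.Gamma (μ + 1 / 2) = A at *
      generalize Real.Gamma ((l : ℝ) + μ + 1 / 2) = B at *
      field_simp
      linear_combination (-genFactorial μ _) * hs
    · rw [if_neg (by simp; omega), coeff_hermitePoly_eq_zero μ _ _ (Or.inl (by omega))]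
  · rw [coeff_hermitePoly_eq_zero μ _ _ (Or.inr ⟨m + l, by ring⟩)]
    refine (Finset.sum_eq_zero fun k _ => if_neg (by omega)).symm

theorem hermitePoly_two_mul_add_one {μ : ℝ} (hμ : -(1 / 2 : ℝ) < μ) (m : ℕ) :
    hermitePoly μ (2 * m + 1) = ∑ k ∈ Finset.range (m + 1), Polynomial.monomial (2 * k + 1)
      ((genFactorial μ (2 * m + 1) / (2 * m + 1)! * ((-1) ^ m * ((2 * m + 1)! / m !) *
        ((-1) ^ k * m.choose k *
        (Real.Gamma (μ + 1 / 2) / Real.Gamma (k + μ + 3 / 2)))) : ℝ) : ℂ) := by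
  ext j
  rw [Polynomial.finsetSum_coeff]
  simp only [Polynomial.coeff_monomial]
  rcases Nat.even_or_odd' j with ⟨l, rfl | rfl⟩
  · rw [coeff_hermitePoly_eq_zero μ _ _ (Or.inr ⟨m + l, by ring⟩)]
    refine (Finset.sum_eq_zero fun k _ => if_neg (by omega)).symm
  · simp only [add_left_inj, mul_right_inj' (two_ne_zero' ℕ)]
    rw [Finset.sum_ite_eq']
    by_cases hl : l ≤ m
    · obtain ⟨i, rfl⟩ := Nat.exists_eq_add_of_le hl
      rw [if_pos (by simp), coeff_hermitePoly hμ _ i (2 * l + 1) (by ring)]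
      congr 1
      have hG := (gamma_half_pos hμ).ne'
      have hG2 : Real.Gamma ((l : ℝ) + μ + 3 / 2) ≠ 0 :=
        (Real.Gamma_pos_of_pos (by have : (0 : ℝ) ≤ l := l.cast_nonneg
                                   linarith)).ne'
      have e : genFactorial μ (2 * l + 1)
          = 2 ^ (2 * l + 1) * l ! * Real.Gamma (l + μ + 3 / 2) / Real.Gamma (μ + 1 / 2) := by
        have h2 : (2 * l + 1) / 2 = l := by omega
        simp [genFactorial, h2]
      have hch : (((l + i).choose l : ℕ) : ℝ) = (l + i)! / (l ! * i !) := by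
        rw [Nat.cast_choose ℝ (Nat.le_add_right l i), Nat.add_sub_cancel_left]
      have hs : ((-1 : ℝ) ^ l) * (-1) ^ l = 1 := by rw [← mul_pow]; simp
      rw [e, hch, pow_add (-1 : ℝ) l i]
      generalize Real.Gamma (μ + 1 / 2) = A at *
      generalize Real.Gamma ((l : ℝ) + μ + 3 / 2) = B at *
      field_simp
      linear_combination (-genFactorial μ _) * hs
    · rw [if_neg (by simp; omega), coeff_hermitePoly_eq_zero μ _ _ (Or.inl (by omega))]

theorem eval_hermitePoly {μ : ℝ} (hμ : -(1 / 2 : ℝ) < μ) (n : ℕ) (x : ℝ) :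
    (hermitePoly μ n).eval (x : ℂ) = ((genFactorial μ n / n ! * genHermite μ n x : ℝ) : ℂ) := by
  rcases Nat.even_or_odd' n with ⟨m, rfl | rfl⟩
  · rw [hermitePoly_two_mul hμ, Polynomial.eval_finsetSum]
    simp only [Polynomial.eval_monomial, genHermite, even_two_mul, if_true,
      Nat.mul_div_cancel_left m two_pos]
    rw [Finset.mul_sum, Finset.mul_sum, Complex.ofReal_sum]
    refine Finset.sum_congr rfl fun k _ => ?_
    push_cast
    ring
  · have h1 : ¬ Even (2 * m + 1) := by simp
    have h2 : (2 * m + 1) / 2 = m := by omega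
    rw [hermitePoly_two_mul_add_one hμ, Polynomial.eval_finsetSum]
    simp only [Polynomial.eval_monomial, genHermite, h1, if_false, h2]
    rw [Finset.mul_sum, Finset.mul_sum, Complex.ofReal_sum]
    refine Finset.sum_congr rfl fun k _ => ?_
    push_cast
    ring

/-- The normalization constant of the generalized Hermite functions. -/
noncomputable def hermiteConst (μ : ℝ) (n : ℕ) : ℝ :=
  Real.sqrt (genFactorial μ n / Real.Gamma (μ + 1 / 2)) / ((2 : ℝ) ^ ((n : ℝ) / 2) *
    genFactorial μ n)

/-- The third factor is the squared norm of `hermitePoly μ n` in the weight exp(-t²)|t|^(2μ), so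
this says that φ_n has norm one. -/
theorem hermiteConst_sq {μ : ℝ} (hμ : -(1 / 2 : ℝ) < μ) (n : ℕ) :
    hermiteConst μ n * hermiteConst μ n * (2 ^ n * genFactorial μ n * Real.Gamma (μ + 1 / 2))
      = 1 := by
  have hγ := genFactorial_pos hμ n
  have hG := gamma_half_pos hμ
  have h1 : Real.sqrt (genFactorial μ n / Real.Gamma (μ + 1 / 2))
      * Real.sqrt (genFactorial μ n / Real.Gamma (μ + 1 / 2))
      = genFactorial μ n / Real.Gamma (μ + 1 / 2) := Real.mul_self_sqrt (by positivity)
  have h2 : (2 : ℝ) ^ ((n : ℝ) / 2) * (2 : ℝ) ^ ((n : ℝ) / 2) = 2 ^ n := by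
    rw [← Real.rpow_add two_pos, add_halves, Real.rpow_natCast]
  rw [hermiteConst, div_mul_div_comm, h1, mul_mul_mul_comm, h2]
  generalize Real.Gamma (μ + 1 / 2) = A at *
  field_simp

theorem hermiteConst_ne_zero {μ : ℝ} (hμ : -(1 / 2 : ℝ) < μ) (n : ℕ) :
    hermiteConst μ n ≠ 0 := by
  intro h
  have := hermiteConst_sq hμ n
  simp [h] at this

theorem hermiteFun_eq {μ : ℝ} (hμ : -(1 / 2 : ℝ) < μ) (n : ℕ) (x : ℝ) :
    hermiteFun μ n x = hermiteConst μ n *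
      ((hermitePoly μ n).eval (x : ℂ) * (Real.exp (-(1 / 2 * x ^ 2)) : ℝ)) := by
  have hγ := (genFactorial_pos hμ n).ne'
  rw [eval_hermitePoly hμ, hermiteFun, hermiteConst, ← Complex.ofReal_mul, ← Complex.ofReal_mul]
  congr 1
  rw [show -(x ^ 2) / 2 = -(1 / 2 * x ^ 2) by ring]
  field_simp

/-! ### Orthonormality and completeness of the Hermite functions -/

theorem memLp_polynomial_mul_gaussian {μ a : ℝ} (hμ : -(1 / 2 : ℝ) < μ) (ha : 0 < a)
    (p : Polynomial ℂ) :
    MemLp (fun t : ℝ => p.eval (t : ℂ) * (Real.exp (-(a * t ^ 2)) : ℝ)) 2 (weightMeasure μ) := by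
  induction p using Polynomial.induction_on' with
  | add p q hp hq =>
    simp only [Polynomial.eval_add, add_mul]
    exact hp.add hq
  | monomial n c =>
    refine (((memLp_pow_mul_gaussian hμ ha n).ofReal (K := ℂ)).const_mul c).ae_eq
      (Filter.Eventually.of_forall fun t => ?_)
    change c * ((Real.exp (-(a * t ^ 2)) * t ^ n : ℝ) : ℂ) = _
    simp only [Polynomial.eval_monomial]
    push_cast
    ring

theorem memLp_hermiteFun {μ : ℝ} (hμ : -(1 / 2 : ℝ) < μ) (n : ℕ) :
    MemLp (hermiteFun μ n) 2 (weightMeasure μ) := by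
  rw [show hermiteFun μ n = _ from funext (hermiteFun_eq hμ n)]
  exact (memLp_polynomial_mul_gaussian hμ (by norm_num) _).const_mul _

theorem integral_hermiteFun_mul {μ : ℝ} (hμ : -(1 / 2 : ℝ) < μ) (m n : ℕ) :
    ∫ t, hermiteFun μ m t * hermiteFun μ n t ∂(weightMeasure μ)
      = hermiteConst μ m * hermiteConst μ n *
        gaussIntegral μ 1 (hermitePoly μ m * hermitePoly μ n) := by
  rw [gaussIntegral_eq_integral hμ one_pos, ← integral_const_mul]
  refine integral_congr_ae (Filter.Eventually.of_forall fun t => ?_)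
  simp only [hermiteFun_eq hμ, Polynomial.eval_mul]
  have e : Real.exp (-(1 * t ^ 2)) = Real.exp (-(1 / 2 * t ^ 2)) * Real.exp (-(1 / 2 * t ^ 2)) := by
    rw [← Real.exp_add]; congr 1; ring
  rw [e]
  push_cast
  ring

theorem orthonormal_hermiteFun {μ : ℝ} (hμ : -(1 / 2 : ℝ) < μ) :
    Orthonormal ℂ fun n : ℕ => (memLp_hermiteFun hμ n).toLp (hermiteFun μ n) := by
  rw [orthonormal_iff_ite]
  intro m n
  have h : inner ℂ ((memLp_hermiteFun hμ m).toLp (hermiteFun μ m))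
      ((memLp_hermiteFun hμ n).toLp (hermiteFun μ n))
      = ∫ t, hermiteFun μ m t * hermiteFun μ n t ∂(weightMeasure μ) := by
    rw [L2.inner_def]
    refine integral_congr_ae ?_
    filter_upwards [(memLp_hermiteFun hμ m).coeFn_toLp, (memLp_hermiteFun hμ n).coeFn_toLp]
      with t h1 h2
    rw [h1, h2, RCLike.inner_apply, mul_comm, hermiteFun, Complex.conj_ofReal]
  rw [h, integral_hermiteFun_mul hμ]
  split_ifs with hmn
  · subst hmn
    rw [gaussIntegral_hermitePoly_sq hμ]
    exact_mod_cast hermiteConst_sq hμ m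
  · rcases lt_or_gt_of_ne hmn with hlt | hlt
    · rw [mul_comm (hermitePoly μ m), gaussIntegral_hermitePoly_mul_of_lt hμ hlt, mul_zero]
    · rw [gaussIntegral_hermitePoly_mul_of_lt hμ hlt, mul_zero]

theorem span_range_hermitePoly {μ : ℝ} (hμ : -(1 / 2 : ℝ) < μ) :
    Submodule.span ℂ (Set.range (hermitePoly μ)) = ⊤ := by
  have hdeg : ∀ n, (hermitePoly μ n).degree = n := fun n => by
    refine le_antisymm ?_ (Polynomial.le_degree_of_ne_zero ?_)
    · rw [Polynomial.degree_le_iff_coeff_zero]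
      intro j hj
      exact coeff_hermitePoly_eq_zero μ n j (Or.inl (by exact_mod_cast hj))
    · rw [coeff_hermitePoly_self hμ]
      exact pow_ne_zero _ two_ne_zero
  let S : Polynomial.Sequence ℂ := ⟨hermitePoly μ, hdeg⟩
  exact S.span fun i => (Polynomial.leadingCoeff_ne_zero.2 (S.ne_zero i)).isUnit

/-- The polynomials H_n span all polynomials, so a vector orthogonal to every φ_n has vanishing
moments against exp(-t²/2), and completeness of the Gaussian monomials applies. -/
theorem closure_span_hermiteFun {μ : ℝ} (hμ : -(1 / 2 : ℝ) < μ) :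
    (Submodule.span ℂ (Set.range fun n : ℕ =>
      (memLp_hermiteFun hμ n).toLp (hermiteFun μ n))).topologicalClosure = ⊤ := by
  rw [Submodule.topologicalClosure_eq_top_iff, Submodule.eq_bot_iff]
  intro v hv
  have hv0 : ∀ n, ∫ t, hermiteFun μ n t * v t ∂(weightMeasure μ) = 0 := fun n => by
    have h := (Submodule.mem_orthogonal _ v).1 hv _ (Submodule.subset_span ⟨n, rfl⟩)
    rw [← h, L2.inner_def]
    refine integral_congr_ae ?_
    filter_upwards [(memLp_hermiteFun hμ n).coeFn_toLp] with t h1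
    rw [h1, RCLike.inner_apply, hermiteFun, Complex.conj_ofReal, mul_comm]
  have hint : ∀ p : Polynomial ℂ, Integrable (fun t : ℝ =>
      p.eval (t : ℂ) * (Real.exp (-(1 / 2 * t ^ 2)) : ℝ) * v t) (weightMeasure μ) := fun p =>
    (memLp_polynomial_mul_gaussian hμ (by norm_num) p).integrable_mul (Lp.memLp v)
  have hp : ∀ p : Polynomial ℂ,
      ∫ t : ℝ, p.eval (t : ℂ) * (Real.exp (-(1 / 2 * t ^ 2)) : ℝ) * v t ∂(weightMeasure μ) = 0 := by
    intro p
    have hmem : p ∈ Submodule.span ℂ (Set.range (hermitePoly μ)) := by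
      rw [span_range_hermitePoly hμ]; trivial
    induction hmem using Submodule.span_induction with
    | mem x hx =>
      obtain ⟨n, rfl⟩ := hx
      have h := hv0 n
      simp_rw [hermiteFun_eq hμ, mul_assoc] at h
      rw [integral_const_mul] at h
      simp_rw [mul_assoc]
      exact (mul_eq_zero.1 h).resolve_left (by exact_mod_cast hermiteConst_ne_zero hμ n)
    | zero => simp
    | add x y _ _ hx hy =>
      simp only [Polynomial.eval_add, add_mul]
      rw [integral_add (hint x) (hint y), hx, hy, add_zero]
    | smul c x _ hx =>
      simp only [Polynomial.eval_smul, smul_eq_mul, mul_assoc] at hx ⊢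
      rw [integral_const_mul, hx, mul_zero]
  rw [Lp.eq_zero_iff_ae_eq_zero]
  refine ae_eq_zero_of_forall_integral_pow_mul_gaussian hμ (a := 1 / 2) (by norm_num)
    (Lp.memLp v) fun n => ?_
  rw [← hp (Polynomial.X ^ n)]
  refine integral_congr_ae (Filter.Eventually.of_forall fun t => ?_)
  simp only [Polynomial.eval_pow, Polynomial.eval_X]
  push_cast
  ring

/-! ### Taylor series of the transform -/

/-- The Taylor series of `exp(-x²/2)`. -/
noncomputable def gaussSeries : PowerSeries ℂ :=
  PowerSeries.mk fun j => if Even j then (-1 / 2) ^ (j / 2) / ((j / 2)! : ℂ) else 0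

theorem coeff_gaussSeries_two_mul (j : ℕ) :
    PowerSeries.coeff (2 * j) gaussSeries = (-1 / 2) ^ j / (j ! : ℂ) := by
  simp [gaussSeries]

theorem coeff_gaussSeries_of_odd {j : ℕ} (hj : Odd j) :
    PowerSeries.coeff j gaussSeries = 0 := by
  simp [gaussSeries, Nat.not_even_iff_odd.2 hj]

theorem hasSum_gaussSeries (x : ℝ) :
    HasSum (fun k => PowerSeries.coeff k gaussSeries * (x : ℂ) ^ k)
      ((Real.exp (-(1 / 2 * x ^ 2)) : ℝ) : ℂ) := by
  have h : HasSum (fun j : ℕ => PowerSeries.coeff (2 * j) gaussSeries * (x : ℂ) ^ (2 * j))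
      ((Real.exp (-(1 / 2 * x ^ 2)) : ℝ) : ℂ) := by
    have := NormedSpace.expSeries_div_hasSum_exp (-(1 / 2 * (x : ℂ) ^ 2))
    rw [← Complex.exp_eq_exp_ℂ] at this
    push_cast
    refine this.congr_fun fun j => ?_
    rw [coeff_gaussSeries_two_mul, show -(1 / 2 * (x : ℂ) ^ 2) = (-1 / 2) * x ^ 2 by ring, mul_pow,
      ← pow_mul]
    ring
  have hi : Function.Injective fun j : ℕ => 2 * j := fun a b h => by simpa using h
  refine (hi.hasSum_iff fun k hk => ?_).1 h
  have : Odd k := by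
    rw [← Nat.not_even_iff_odd]
    rintro ⟨r, rfl⟩
    exact hk ⟨r, by simp only; ring⟩
  rw [coeff_gaussSeries_of_odd this, zero_mul]

theorem hasSum_polynomial_mul_gaussSeries (p : Polynomial ℂ) (x : ℝ) :
    HasSum (fun k => PowerSeries.coeff k ((p : PowerSeries ℂ) * gaussSeries) * (x : ℂ) ^ k)
      (p.eval (x : ℂ) * (Real.exp (-(1 / 2 * x ^ 2)) : ℝ)) := by
  induction p using Polynomial.induction_on' with
  | add p q hp hq =>
    simp only [Polynomial.coe_add, add_mul, map_add, Polynomial.eval_add]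
    exact hp.add hq
  | monomial n c =>
    have h := (hasSum_gaussSeries x).mul_left (c * (x : ℂ) ^ n)
    have hi : Function.Injective fun j : ℕ => n + j := add_right_injective n
    rw [Polynomial.eval_monomial]
    refine (hi.hasSum_iff fun k hk => ?_).1 (h.congr_fun fun j => ?_)
    · have hkn : ¬ n ≤ k := fun hle => hk ⟨k - n, by simp only; omega⟩
      rw [← Polynomial.C_mul_X_pow_eq_monomial, Polynomial.coe_mul, Polynomial.coe_C,
        Polynomial.coe_pow, Polynomial.coe_X, mul_assoc, PowerSeries.coeff_C_mul,
        PowerSeries.coeff_X_pow_mul', if_neg hkn]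
      simp
    · rw [Function.comp_apply, ← Polynomial.C_mul_X_pow_eq_monomial, Polynomial.coe_mul,
        Polynomial.coe_C, Polynomial.coe_pow, Polynomial.coe_X, mul_assoc, PowerSeries.coeff_C_mul,
        PowerSeries.coeff_X_pow_mul', if_pos (by omega), Nat.add_sub_cancel_left, pow_add]
      ring

theorem mul_coeff_gaussSeries (j : ℕ) :
    ((j : ℂ) + 2) * PowerSeries.coeff (j + 2) gaussSeries = -PowerSeries.coeff j gaussSeries := by
  rcases Nat.even_or_odd' j with ⟨i, rfl | rfl⟩
  · rw [show 2 * i + 2 = 2 * (i + 1) by ring, coeff_gaussSeries_two_mul,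
      coeff_gaussSeries_two_mul, Nat.factorial_succ, pow_succ]
    have h1 : ((i : ℂ) + 1) ≠ 0 := by exact_mod_cast i.succ_ne_zero
    have h2 : (i ! : ℂ) ≠ 0 := by exact_mod_cast i.factorial_ne_zero
    push_cast
    field_simp
  · rw [coeff_gaussSeries_of_odd ⟨i, rfl⟩, coeff_gaussSeries_of_odd ⟨i + 1, by ring⟩]
    simp

/-- The Dunkl operator applied to `p(x) exp(-x²/2)`. -/
theorem dunklCoeff_mul_coeff_polynomial_mul_gaussSeries (μ : ℝ) (p : Polynomial ℂ) (k : ℕ) :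
    (dunklCoeff μ (k + 1) : ℝ) * PowerSeries.coeff (k + 1) ((p : PowerSeries ℂ) * gaussSeries)
      = PowerSeries.coeff k ((dunklOp μ p : PowerSeries ℂ) * gaussSeries)
        - PowerSeries.coeff k (PowerSeries.X * ((p : PowerSeries ℂ) * gaussSeries)) := by
  induction p using Polynomial.induction_on' with
  | add p q hp hq =>
    simp only [Polynomial.coe_add, add_mul, mul_add, map_add] at hp hq ⊢
    linear_combination hp + hq
  | monomial n c =>
    have hc : ∀ (n : ℕ) (c : ℂ), ((Polynomial.monomial n c : Polynomial ℂ) : PowerSeries ℂ)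
        * gaussSeries = PowerSeries.C c * (PowerSeries.X ^ n * gaussSeries) := fun n c => by
      rw [← Polynomial.C_mul_X_pow_eq_monomial, Polynomial.coe_mul, Polynomial.coe_C,
        Polynomial.coe_pow, Polynomial.coe_X, mul_assoc]
    rw [dunklOp_monomial, hc, hc, mul_left_comm PowerSeries.X, ← mul_assoc PowerSeries.X,
      ← pow_succ', PowerSeries.coeff_C_mul, PowerSeries.coeff_C_mul, PowerSeries.coeff_C_mul,
      PowerSeries.coeff_X_pow_mul', PowerSeries.coeff_X_pow_mul', PowerSeries.coeff_X_pow_mul']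
    by_cases hn : n ≤ k + 1
    · obtain ⟨l, hl⟩ := Nat.exists_eq_add_of_le hn
      rw [if_pos hn, if_pos (by omega), hl, Nat.add_sub_cancel_left]
      have e : ((dunklCoeff μ n : ℝ) : ℂ) * PowerSeries.coeff (k - (n - 1)) gaussSeries
          = (dunklCoeff μ n : ℝ) * PowerSeries.coeff l gaussSeries := by
        rcases n with _ | n
        · simp [dunklCoeff_zero]
        · congr 3; omega
      rw [mul_assoc c, e]
      -- Here l is the exponent contributed by the Gaussian. Its odd coefficients vanish, and
      -- d_{n+l} = d_n + l for even l, so D obeys the Leibniz rule against an even series.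
      match l, hl with
      | 0, hl => rw [if_neg (by omega)]; simp; ring
      | 1, hl => rw [if_neg (by omega), coeff_gaussSeries_of_odd odd_one]; simp
      | l + 2, hl =>
        rw [if_pos (by omega), show k - (n + 1) = l by omega]
        have hr := mul_coeff_gaussSeries l
        rcases Nat.even_or_odd l with h | h
        · rw [dunklCoeff_add_even μ (h.add even_two)]
          push_cast
          linear_combination c * hr
        · rw [coeff_gaussSeries_of_odd h, coeff_gaussSeries_of_odd (h.add_even even_two)]
          simp
    · rw [if_neg hn, if_neg (by omega), if_neg (by omega)]
      simp

/-- The Taylor series of `x ↦ ∫ e_μ(ωxt) p(t) exp(-t²/2) |t|^(2μ) dt`. -/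
noncomputable def transformSeries (μ : ℝ) (ω : ℂ) (p : Polynomial ℂ) : PowerSeries ℂ :=
  PowerSeries.mk fun k => ω ^ k / (genFactorial μ k : ℝ) *
    gaussIntegral μ (1 / 2) (Polynomial.X ^ k * p)

theorem transformSeries_one {μ : ℝ} (hμ : -(1 / 2 : ℝ) < μ) {ω : ℂ} (hω : ω ^ 2 = -1) :
    transformSeries μ ω 1 = PowerSeries.C ((gaussMoment μ (1 / 2) 0 : ℝ) : ℂ) * gaussSeries := by
  ext k
  rw [PowerSeries.coeff_C_mul, transformSeries, PowerSeries.coeff_mk, mul_one,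
    ← Polynomial.monomial_one_right_eq_X_pow, gaussIntegral_monomial, one_mul]
  rcases Nat.even_or_odd' k with ⟨j, rfl | rfl⟩
  · have h1 : ((genFactorial μ (2 * j) : ℝ) : ℂ) ≠ 0 := by
      exact_mod_cast (genFactorial_pos hμ _).ne'
    rw [gaussMoment_half_two_mul hμ, coeff_gaussSeries_two_mul, pow_mul, hω]
    have h2 : (j ! : ℂ) ≠ 0 := by exact_mod_cast j.factorial_ne_zero
    rw [div_pow]
    push_cast
    field_simp
  · rw [gaussMoment_of_odd μ _ ⟨j, rfl⟩, coeff_gaussSeries_of_odd ⟨j, rfl⟩]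
    simp

/-- Antisymmetry at a = 1/2 moves D from p onto the kernel, where it becomes multiplication by ωx;
multiplication by t becomes D/ω in x. As 1/ω = -ω, the result is ω(x - D). -/
theorem transformSeries_creation {μ : ℝ} (hμ : -(1 / 2 : ℝ) < μ) {ω : ℂ} (hω : ω ^ 2 = -1)
    (p : Polynomial ℂ) (k : ℕ) :
    PowerSeries.coeff k (transformSeries μ ω
        (Polynomial.C 2 * (Polynomial.X * p) - dunklOp μ p))
      = ω * (PowerSeries.coeff k (PowerSeries.X * transformSeries μ ω p)
        - (dunklCoeff μ (k + 1) : ℝ) * PowerSeries.coeff (k + 1) (transformSeries μ ω p)) := by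
  have hγ : ∀ n, ((genFactorial μ n : ℝ) : ℂ) ≠ 0 := fun n => by
    exact_mod_cast (genFactorial_pos hμ n).ne'
  have hdc : ∀ i, ((dunklCoeff μ (i + 1) : ℝ) : ℂ) ≠ 0 := fun i => by
    exact_mod_cast (dunklCoeff_pos hμ i.succ_pos).ne'
  have h := gaussIntegral_dunklOp_mul hμ (a := 1 / 2) (by norm_num) (Polynomial.X ^ k) p
  have hX : Polynomial.X ^ k * (Polynomial.C 2 * (Polynomial.X * p) - dunklOp μ p)
      = (2 : ℂ) • (Polynomial.X ^ (k + 1) * p) - Polynomial.X ^ k * dunklOp μ p := by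
    rw [Polynomial.smul_eq_C_mul]; ring
  rw [← pow_succ'] at h
  simp only [transformSeries, PowerSeries.coeff_mk]
  rw [hX, map_sub, map_smul, smul_eq_mul, genFactorial_succ hμ]
  have h1 := hγ k
  have h2 := hdc k
  have hp := pow_succ ω k
  rcases k with _ | k
  · rw [PowerSeries.coeff_zero_X_mul]
    rw [← Polynomial.monomial_one_right_eq_X_pow, dunklOp_monomial, dunklCoeff_zero] at h
    simp only [Complex.ofReal_zero, mul_zero, zero_mul,
      map_zero, zero_add] at h
    rw [Polynomial.monomial_one_right_eq_X_pow] at h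
    rw [h]
    push_cast
    field_simp
    linear_combination (gaussIntegral μ (1 / 2) (Polynomial.X ^ (0 + 1) * p)) * hω
  · rw [PowerSeries.coeff_succ_X_mul, PowerSeries.coeff_mk, genFactorial_succ hμ]
    have h3 := hγ k
    have h4 := hdc k
    rw [← Polynomial.monomial_one_right_eq_X_pow (k + 1), dunklOp_monomial, Nat.add_sub_cancel,
      one_mul, ← mul_one ((dunklCoeff μ (k + 1) : ℝ) : ℂ), ← smul_eq_mul _ (1 : ℂ),
      ← Polynomial.smul_monomial, smul_mul_assoc, map_smul, smul_eq_mul,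
      Polynomial.monomial_one_right_eq_X_pow, Polynomial.monomial_one_right_eq_X_pow] at h
    have hE := eq_sub_of_add_eq' h
    rw [hE]
    generalize gaussIntegral μ (1 / 2) (Polynomial.X ^ (k + 1 + 1) * p) = A
    push_cast
    field_simp
    linear_combination (A * ω * ω ^ k) * hω

/-- Induction along creation operators: (x - D)(p exp(-x²/2)) = (2xp - Dp) exp(-x²/2), and each step
contributes one factor ω. -/
theorem transformSeries_hermitePoly {μ : ℝ} (hμ : -(1 / 2 : ℝ) < μ) {ω : ℂ} (hω : ω ^ 2 = -1)
    (n : ℕ) :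
    transformSeries μ ω (hermitePoly μ n) = PowerSeries.C (ω ^ n * (gaussMoment μ (1 / 2) 0 : ℝ))
      * ((hermitePoly μ n : PowerSeries ℂ) * gaussSeries) := by
  induction n with
  | zero => simp [hermitePoly, transformSeries_one hμ hω]
  | succ n ih =>
    ext k
    rw [hermitePoly, transformSeries_creation hμ hω, ih, PowerSeries.coeff_C_mul,
      PowerSeries.coeff_C_mul, mul_left_comm PowerSeries.X, PowerSeries.coeff_C_mul,
      Polynomial.coe_sub, Polynomial.coe_mul, Polynomial.coe_mul, Polynomial.coe_C,
      Polynomial.coe_X, sub_mul, mul_assoc (PowerSeries.C 2), map_sub, PowerSeries.coeff_C_mul,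
      mul_assoc PowerSeries.X]
    have h := dunklCoeff_mul_coeff_polynomial_mul_gaussSeries μ (hermitePoly μ n) k
    linear_combination (-ω * ω ^ n * (gaussMoment μ (1 / 2) 0 : ℝ)) * h

/-! ### The transform -/

/-- The transform with kernel `e_μ(ωxt)`, as an integral against `weightMeasure μ`. -/
noncomputable def transform (μ : ℝ) (ω : ℂ) (f : ℝ → ℂ) (x : ℝ) : ℂ :=
  (((2 : ℝ) ^ (μ + 1 / 2) * Real.Gamma (μ + 1 / 2) : ℝ) : ℂ)⁻¹ *
    ∫ t : ℝ, genExp μ (ω * x * t) * f t ∂(weightMeasure μ)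

theorem fourierIntegralW_eq_transform (μ : ℝ) :
    fourierIntegralW μ = transform μ (-Complex.I) := by
  funext f x
  rw [fourierIntegralW, transform, integral_weightMeasure]

theorem fourierIntegralInvW_eq_transform (μ : ℝ) :
    fourierIntegralInvW μ = transform μ Complex.I := by
  funext f x
  rw [fourierIntegralInvW, transform, integral_weightMeasure]

theorem norm_genExp_mul_le {μ : ℝ} (hμ : -(1 / 2 : ℝ) < μ) {ω : ℂ} (hω : ‖ω‖ = 1) (x t : ℝ) :
    ‖genExp μ (ω * x * t)‖ ≤ Real.exp ((dunklLower μ)⁻¹ * |x| * |t|) := by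
  refine (norm_genExp_le hμ _).trans (le_of_eq ?_)
  rw [norm_mul, norm_mul, hω, Complex.norm_real, Complex.norm_real, Real.norm_eq_abs,
    Real.norm_eq_abs]
  ring_nf

theorem integrable_genExp_mul_of_mem_gaussSpan {μ : ℝ} (hμ : -(1 / 2 : ℝ) < μ) {ω : ℂ}
    (hω : ‖ω‖ = 1) {a : ℝ} (ha : 0 < a) {f : ℝ → ℂ} (hf : f ∈ gaussSpan a) (x : ℝ) :
    Integrable (fun t : ℝ => genExp μ (ω * x * t) * f t) (weightMeasure μ) := by
  induction hf using Submodule.span_induction with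
  | mem f hf =>
    obtain ⟨n, rfl⟩ := hf
    have hc := continuous_genExp hμ
    refine (integrable_abs_pow_mul_exp_mul_gaussian hμ ha ((dunklLower μ)⁻¹ * |x|) n).mono'
      (Continuous.aestronglyMeasurable (by fun_prop)) (Filter.Eventually.of_forall fun t => ?_)
    rw [norm_mul, Complex.norm_real, norm_mul, norm_pow, Real.norm_eq_abs t,
      Real.norm_of_nonneg (Real.exp_pos _).le]
    calc _ ≤ Real.exp ((dunklLower μ)⁻¹ * |x| * |t|) * (Real.exp (-(a * t ^ 2)) * |t| ^ n) := by
          gcongr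
          exact norm_genExp_mul_le hμ hω x t
      _ = _ := by ring
  | zero => simp
  | add f g _ _ hf hg => 
    simp only [Pi.add_apply, mul_add]
    exact hf.add hg
  | smul c f _ hf =>
    refine (hf.const_mul c).congr (Filter.Eventually.of_forall fun t => ?_)
    simp only [Pi.smul_apply, smul_eq_mul]
    ring

theorem memLp_of_mem_gaussSpan {μ : ℝ} (hμ : -(1 / 2 : ℝ) < μ) {a : ℝ} (ha : 0 < a)
    {f : ℝ → ℂ} (hf : f ∈ gaussSpan a) : MemLp f 2 (weightMeasure μ) := by
  induction hf using Submodule.span_induction with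
  | mem f hf =>
    obtain ⟨n, rfl⟩ := hf
    exact (memLp_pow_mul_gaussian hμ ha n).ofReal
  | zero => exact MemLp.zero
  | add f g _ _ hf hg => exact hf.add hg
  | smul c f _ hf => exact hf.const_smul c

theorem hasSum_transform {μ : ℝ} (hμ : -(1 / 2 : ℝ) < μ) {ω : ℂ} (hω : ‖ω‖ = 1)
    (p : Polynomial ℂ) (x : ℝ) :
    HasSum (fun k => PowerSeries.coeff k (transformSeries μ ω p) * (x : ℂ) ^ k)
      (∫ t : ℝ, genExp μ (ω * x * t) * (p.eval (t : ℂ) * (Real.exp (-(1 / 2 * t ^ 2)) : ℝ))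
        ∂(weightMeasure μ)) := by
  have hpos := dunklLower_pos hμ
  have hint : Integrable (fun t : ℝ => Real.exp ((dunklLower μ)⁻¹ * |x| * |t|) *
      ‖p.eval (t : ℂ) * (Real.exp (-(1 / 2 * t ^ 2)) : ℝ)‖) (weightMeasure μ) := by
    induction p using Polynomial.induction_on' with
    | add p q hp hq =>
      refine (hp.add hq).mono' (by fun_prop) (Filter.Eventually.of_forall fun t => ?_)
      rw [Real.norm_of_nonneg (by positivity), Pi.add_apply, ← mul_add, Polynomial.eval_add,
        add_mul]
      gcongr
      exact norm_add_le _ _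
    | monomial n c =>
      refine ((integrable_abs_pow_mul_exp_mul_gaussian hμ (a := 1 / 2) (by norm_num)
        ((dunklLower μ)⁻¹ * |x|) n).const_mul ‖c‖).congr (Filter.Eventually.of_forall fun t => ?_)
      simp only [Polynomial.eval_monomial]
      rw [norm_mul, norm_mul, norm_pow, Complex.norm_real, Complex.norm_real, Real.norm_eq_abs,
        Real.norm_of_nonneg (Real.exp_pos _).le]
      ring
  refine (hasSum_integral_of_dominated_convergence
    (F := fun (k : ℕ) (t : ℝ) => (ω * x * t) ^ k / (genFactorial μ k : ℂ) *
      (p.eval (t : ℂ) * (Real.exp (-(1 / 2 * t ^ 2)) : ℝ)))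
    (fun k t => ((dunklLower μ)⁻¹ * |x| * |t|) ^ k / k ! *
      ‖p.eval (t : ℂ) * (Real.exp (-(1 / 2 * t ^ 2)) : ℝ)‖)
    (fun k => Continuous.aestronglyMeasurable (by fun_prop))
    (fun k => Filter.Eventually.of_forall fun t => ?_)
    (Filter.Eventually.of_forall fun t => (Real.summable_pow_div_factorial _).mul_right _)
    ?_ (Filter.Eventually.of_forall fun t => (hasSum_genExp hμ _).mul_right _)).congr_fun
    fun k => ?_
  · rw [norm_mul]
    gcongr
    rw [norm_div, norm_pow, Complex.norm_real, Real.norm_of_nonneg (genFactorial_pos hμ k).le,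
      norm_mul, norm_mul, hω, Complex.norm_real, Complex.norm_real, Real.norm_eq_abs,
      Real.norm_eq_abs, div_eq_mul_inv, one_mul, mul_assoc, mul_pow ((dunklLower μ)⁻¹),
      mul_comm ((dunklLower μ)⁻¹ ^ k), mul_div_assoc]
    gcongr
    exact inv_genFactorial_le hμ k
  · refine hint.congr (Filter.Eventually.of_forall fun t => ?_)
    simp only
    rw [tsum_mul_right, Real.exp_eq_exp_ℝ, NormedSpace.exp_eq_tsum_div]
  · rw [transformSeries, PowerSeries.coeff_mk, gaussIntegral_eq_integral hμ (by norm_num),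
      mul_right_comm, ← integral_const_mul]
    refine integral_congr_ae (Filter.Eventually.of_forall fun t => ?_)
    simp only [Polynomial.eval_mul, Polynomial.eval_pow, Polynomial.eval_X]
    ring

theorem norm_eq_one_of_sq_eq_neg_one {ω : ℂ} (hω : ω ^ 2 = -1) : ‖ω‖ = 1 := by
  have := congrArg norm hω
  rw [norm_pow, norm_neg, norm_one] at this
  exact (pow_eq_one_iff_of_nonneg (norm_nonneg _) two_ne_zero).1 this

/-- The generalized Hermite functions are eigenfunctions of the transform. -/
theorem transform_hermiteFun {μ : ℝ} (hμ : -(1 / 2 : ℝ) < μ) {ω : ℂ} (hω : ω ^ 2 = -1)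
    (n : ℕ) (x : ℝ) :
    transform μ ω (hermiteFun μ n) x = ω ^ n * hermiteFun μ n x := by
  have hω1 := norm_eq_one_of_sq_eq_neg_one hω
  have h1 := hasSum_transform hμ hω1 (hermitePoly μ n) x
  have h2 := (hasSum_polynomial_mul_gaussSeries (hermitePoly μ n) x).mul_left
    (ω ^ n * (gaussMoment μ (1 / 2) 0 : ℝ))
  rw [transformSeries_hermitePoly hμ hω] at h1
  simp only [PowerSeries.coeff_C_mul, mul_assoc] at h1 h2
  have h3 := h1.unique h2
  -- The integral of exp(-t²/2)|t|^(2μ) is exactly the normalizing constant, so the eigenvalue is ωⁿ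
  -- with no extra factor.
  have hM : gaussMoment μ (1 / 2) 0 = (2 : ℝ) ^ (μ + 1 / 2) * Real.Gamma (μ + 1 / 2) := by
    rw [gaussMoment_zero hμ (by norm_num), one_div, Real.inv_rpow two_pos.le, Real.rpow_neg
      two_pos.le, inv_inv]
  have hM0 : (((2 : ℝ) ^ (μ + 1 / 2) * Real.Gamma (μ + 1 / 2) : ℝ) : ℂ) ≠ 0 := by
    have := gamma_half_pos hμ
    have : 0 < (2 : ℝ) ^ (μ + 1 / 2) * Real.Gamma (μ + 1 / 2) := by positivity
    exact_mod_cast this.ne'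
  rw [transform]
  have e : ∀ t : ℝ, genExp μ (ω * x * t) * hermiteFun μ n t = hermiteConst μ n *
      (genExp μ (ω * (x * t)) *
        ((hermitePoly μ n).eval (t : ℂ) * (Real.exp (-(1 / 2 * t ^ 2)) : ℝ))) := fun t => by
    rw [hermiteFun_eq hμ, mul_left_comm, mul_assoc ω]
  simp_rw [e]
  rw [integral_const_mul, h3, hM, hermiteFun_eq hμ]
  generalize (((2 : ℝ) ^ (μ + 1 / 2) * Real.Gamma (μ + 1 / 2) : ℝ) : ℂ) = M at hM0 ⊢
  field_simp

/-! ### Passing from one Gaussian width to another -/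

/-- Dominated convergence in `L²`. -/
theorem tendsto_toLp_two_of_dominated {ν : Measure ℝ} {F : ℕ → ℝ → ℂ} {f : ℝ → ℂ} {g : ℝ → ℝ}
    (hF : ∀ n, MemLp (F n) 2 ν) (hf : MemLp f 2 ν) (hg : MemLp g 2 ν)
    (hb : ∀ n t, ‖F n t‖ ≤ g t)
    (hlim : ∀ t, Filter.Tendsto (fun n => F n t) Filter.atTop (nhds (f t))) :
    Filter.Tendsto (fun n => (hF n).toLp (F n)) Filter.atTop (nhds (hf.toLp f)) := by
  rw [Lp.tendsto_Lp_iff_tendsto_eLpNorm'']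
  have hfb : ∀ t, ‖f t‖ ≤ g t := fun t =>
    le_of_tendsto (hlim t).norm (Filter.Eventually.of_forall fun n => hb n t)
  have hint : Integrable (fun t => (2 * g t) ^ 2) ν := (hg.const_mul 2).integrable_sq
  have key : Filter.Tendsto (fun n => ∫⁻ t, ‖(F n - f) t‖ₑ ^ (2 : ℝ) ∂ν) Filter.atTop (nhds 0) := by
    have := tendsto_lintegral_of_dominated_convergence' (μ := ν)
      (F := fun n t => ‖(F n - f) t‖ₑ ^ (2 : ℝ)) (f := fun _ => 0)
      (fun t => ENNReal.ofReal ((2 * g t) ^ 2))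
      (fun n => (((hF n).sub hf).aestronglyMeasurable.enorm).pow_const _)
      (fun n => Filter.Eventually.of_forall fun t => ?_) hint.lintegral_lt_top.ne
      (Filter.Eventually.of_forall fun t => ?_)
    · simpa using this
    · have h1 : ‖F n t - f t‖ ≤ 2 * g t := by
        have := norm_sub_le (F n t) (f t)
        have := hb n t
        have := hfb t
        linarith
      simp only [Pi.sub_apply]
      rw [← ofReal_norm, ENNReal.rpow_two, ← ENNReal.ofReal_pow (norm_nonneg _)]
      exact ENNReal.ofReal_le_ofReal (pow_le_pow_left₀ (norm_nonneg _) h1 2)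
    · have h1 : Filter.Tendsto (fun n => ‖(F n - f) t‖ₑ) Filter.atTop (nhds 0) := by
        have := ((hlim t).sub_const (f t)).enorm
        simpa using this
      have h2 := (ENNReal.continuous_rpow_const (y := (2 : ℝ))).tendsto 0 |>.comp h1
      simpa [Function.comp_def] using h2
  have h2 := (ENNReal.continuous_rpow_const (y := (1 / 2 : ℝ))).tendsto 0 |>.comp key
  simp only [eLpNorm_eq_lintegral_rpow_enorm_toReal two_ne_zero ENNReal.ofNat_ne_top,
    ENNReal.toReal_ofNat]
  simpa [Function.comp_def] using h2

/-- The function `exp(-a t²) tⁿ`. -/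
noncomputable def gaussMonomial (a : ℝ) (n : ℕ) (t : ℝ) : ℂ :=
  ((Real.exp (-(a * t ^ 2)) * t ^ n : ℝ) : ℂ)

theorem gaussMonomial_mem_gaussSpan (a : ℝ) (n : ℕ) : gaussMonomial a n ∈ gaussSpan a :=
  Submodule.subset_span ⟨n, rfl⟩

theorem transform_add {μ : ℝ} (hμ : -(1 / 2 : ℝ) < μ) {ω : ℂ} (hω : ‖ω‖ = 1) {a : ℝ} (ha : 0 < a)
    {f g : ℝ → ℂ} (hf : f ∈ gaussSpan a) (hg : g ∈ gaussSpan a) (x : ℝ) :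
    transform μ ω (f + g) x = transform μ ω f x + transform μ ω g x := by
  simp only [transform, Pi.add_apply, mul_add]
  rw [integral_add (integrable_genExp_mul_of_mem_gaussSpan hμ hω ha hf x)
    (integrable_genExp_mul_of_mem_gaussSpan hμ hω ha hg x), mul_add]

theorem transform_smul (μ : ℝ) (ω : ℂ) (c : ℂ) (f : ℝ → ℂ) (x : ℝ) :
    transform μ ω (c • f) x = c * transform μ ω f x := by
  simp only [transform, Pi.smul_apply, smul_eq_mul, mul_left_comm _ c]
  rw [integral_const_mul, mul_left_comm]

/-- A continuous linear map extends the transform on `gaussSpan a` as soon as it does so on a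
set of functions which spans `gaussSpan a`. -/
theorem extendsOn_of_spanning {μ : ℝ} (hμ : -(1 / 2 : ℝ) < μ) {ω : ℂ} (hω : ‖ω‖ = 1) {a : ℝ}
    (ha : 0 < a) (G : L2w μ →L[ℂ] L2w μ) {ι : Type} (u : ι → ℝ → ℂ)
    (hu : Submodule.span ℂ (Set.range u) = gaussSpan a)
    (hG : ∀ i, ∃ hf : MemLp (u i) 2 (weightMeasure μ),
      (G (hf.toLp (u i)) : ℝ → ℂ) =ᵐ[weightMeasure μ] transform μ ω (u i)) :
    ExtendsOn μ a (transform μ ω) G := by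
  intro f hf
  suffices h : ∀ h : MemLp f 2 (weightMeasure μ),
      (G (h.toLp f) : ℝ → ℂ) =ᵐ[weightMeasure μ] transform μ ω f from
    ⟨memLp_of_mem_gaussSpan hμ ha hf, h _⟩
  rw [← hu] at hf
  induction hf using Submodule.span_induction with
  | mem f hf =>
    obtain ⟨i, rfl⟩ := hf
    exact fun _ => (hG i).2
  | zero =>
    intro h
    rw [MemLp.toLp_zero, map_zero]
    filter_upwards [Lp.coeFn_zero ℂ 2 (weightMeasure μ)] with x hx
    rw [hx]
    simp [transform]
  | add f g hf' hg' hf hg =>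
    intro h
    rw [hu] at hf' hg'
    have mf := memLp_of_mem_gaussSpan hμ ha hf'
    have mg := memLp_of_mem_gaussSpan hμ ha hg'
    rw [MemLp.toLp_add mf mg, map_add]
    filter_upwards [Lp.coeFn_add (G (mf.toLp f)) (G (mg.toLp g)), hf mf, hg mg] with x h1 h2 h3
    rw [h1, Pi.add_apply, h2, h3, transform_add hμ hω ha hf' hg']
  | smul c f hf' hf =>
    intro h
    rw [hu] at hf'
    have mf := memLp_of_mem_gaussSpan hμ ha hf'
    rw [MemLp.toLp_const_smul c mf, map_smul]
    filter_upwards [Lp.coeFn_smul c (G (mf.toLp f)), hf mf] with x h1 h2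
    rw [h1, Pi.smul_apply, h2, transform_smul, smul_eq_mul]

/-- The partial sums of the expansion of `exp(-b t²) tⁿ` into functions `exp(-a t²) tʲ`. -/
noncomputable def gaussPartial (a b : ℝ) (n N : ℕ) : ℝ → ℂ :=
  ∑ k ∈ Finset.range N, (((a - b) ^ k / k ! : ℝ) : ℂ) • gaussMonomial a (n + 2 * k)

theorem gaussPartial_mem_gaussSpan (a b : ℝ) (n N : ℕ) : gaussPartial a b n N ∈ gaussSpan a :=
  Submodule.sum_mem _ fun _ _ => Submodule.smul_mem _ _ (gaussMonomial_mem_gaussSpan _ _)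

theorem gaussPartial_apply (a b : ℝ) (n N : ℕ) (t : ℝ) :
    gaussPartial a b n N t = ((Real.exp (-(a * t ^ 2)) * t ^ n *
      ∑ k ∈ Finset.range N, ((a - b) * t ^ 2) ^ k / k ! : ℝ) : ℂ) := by
  rw [gaussPartial, Finset.sum_apply, Finset.mul_sum, Complex.ofReal_sum]
  refine Finset.sum_congr rfl fun k _ => ?_
  rw [Pi.smul_apply, smul_eq_mul, gaussMonomial, ← Complex.ofReal_mul, pow_add, pow_mul, mul_pow]
  congr 1
  ring

theorem tendsto_gaussPartial (a b : ℝ) (n : ℕ) (t : ℝ) :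
    Filter.Tendsto (fun N => gaussPartial a b n N t) Filter.atTop (nhds (gaussMonomial b n t)) := by
  have h : HasSum (fun k : ℕ => ((a - b) * t ^ 2) ^ k / k !) (Real.exp ((a - b) * t ^ 2)) := by
    rw [Real.exp_eq_exp_ℝ]
    exact NormedSpace.expSeries_div_hasSum_exp _
  have h2 := (Complex.continuous_ofReal.tendsto _).comp
    (h.tendsto_sum_nat.const_mul (Real.exp (-(a * t ^ 2)) * t ^ n))
  have e : gaussMonomial b n t
      = ((Real.exp (-(a * t ^ 2)) * t ^ n * Real.exp ((a - b) * t ^ 2) : ℝ) : ℂ) := by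
    rw [gaussMonomial, mul_right_comm, ← Real.exp_add]
    congr 3
    ring
  simp_rw [gaussPartial_apply, e]
  exact h2

/-- The partial sums of exp((a - b)t²) are at most exp(|a - b|t²). The resulting Gaussian decays
exactly when |a - b| < a, that is, when 0 < b < 2a. -/
theorem norm_gaussPartial_le (a b : ℝ) (n N : ℕ) (t : ℝ) :
    ‖gaussPartial a b n N t‖ ≤ |t| ^ n * Real.exp (-((a - |a - b|) * t ^ 2)) := by
  rw [gaussPartial_apply, Complex.norm_real, norm_mul, norm_mul, norm_pow, Real.norm_eq_abs t,
    Real.norm_of_nonneg (Real.exp_pos _).le]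
  have h : ‖∑ k ∈ Finset.range N, ((a - b) * t ^ 2) ^ k / (k ! : ℝ)‖
      ≤ Real.exp (|a - b| * t ^ 2) := by
    refine (norm_sum_le _ _).trans ?_
    refine le_trans (le_of_eq (Finset.sum_congr rfl fun k _ => ?_))
      (Real.sum_le_exp_of_nonneg (by positivity) N)
    rw [norm_div, norm_pow, norm_mul, Real.norm_eq_abs, Real.norm_of_nonneg (sq_nonneg t),
      Real.norm_natCast]
  calc _ ≤ Real.exp (-(a * t ^ 2)) * |t| ^ n * Real.exp (|a - b| * t ^ 2) := by gcongr
    _ = _ := by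
      rw [mul_comm (Real.exp (-(a * t ^ 2))), mul_assoc, ← Real.exp_add]
      ring_nf

/-- If a bounded operator extends the transform on `gaussSpan a`, then also on `gaussSpan b` for
`b < 2a`. -/
theorem ExtendsOn.of_lt_two_mul {μ : ℝ} (hμ : -(1 / 2 : ℝ) < μ) {ω : ℂ} (hω : ‖ω‖ = 1) {a b : ℝ}
    (hb : 0 < b) (hab : b < 2 * a) {G : L2w μ →L[ℂ] L2w μ}
    (hG : ExtendsOn μ a (transform μ ω) G) : ExtendsOn μ b (transform μ ω) G := by
  have ha : 0 < a := by linarith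
  have hc : 0 < a - |a - b| := by
    rcases abs_cases (a - b) with ⟨h, _⟩ | ⟨h, _⟩ <;> linarith
  refine extendsOn_of_spanning hμ hω hb G (gaussMonomial b) rfl fun n => ?_
  have hF : ∀ N, MemLp (gaussPartial a b n N) 2 (weightMeasure μ) := fun N =>
    memLp_of_mem_gaussSpan hμ ha (gaussPartial_mem_gaussSpan a b n N)
  have hf : MemLp (gaussMonomial b n) 2 (weightMeasure μ) :=
    memLp_of_mem_gaussSpan hμ hb (gaussMonomial_mem_gaussSpan b n)
  refine ⟨hf, ?_⟩
  have hg : MemLp (fun t => |t| ^ n * Real.exp (-((a - |a - b|) * t ^ 2))) 2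
      (weightMeasure μ) := by
    simpa using memLp_abs_pow_mul_exp_mul_gaussian hμ hc 0 n
  have hL := (G.continuous.tendsto _).comp (tendsto_toLp_two_of_dominated hF hf hg
    (norm_gaussPartial_le a b n) (tendsto_gaussPartial a b n))
  -- Continuity of G gives convergence in L² only. A subsequence converges almost everywhere,
  -- whereas the integrals converge at every x, and this identifies the two limits.
  obtain ⟨s, hs, hae⟩ := (tendstoInMeasure_of_tendsto_Lp hL).exists_seq_tendsto_ae
  have hT : ∀ x, Filter.Tendsto (fun N => transform μ ω (gaussPartial a b n N) x) Filter.atTop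
      (nhds (transform μ ω (gaussMonomial b n) x)) := fun x => by
    refine Filter.Tendsto.const_mul _ ?_
    have hcont := continuous_genExp hμ
    refine tendsto_integral_of_dominated_convergence (fun t => |t| ^ n *
      (Real.exp ((dunklLower μ)⁻¹ * |x| * |t|) * Real.exp (-((a - |a - b|) * t ^ 2))))
      (fun N => (integrable_genExp_mul_of_mem_gaussSpan hμ hω ha
        (gaussPartial_mem_gaussSpan a b n N) x).aestronglyMeasurable)
      (integrable_abs_pow_mul_exp_mul_gaussian hμ hc _ n)
      (fun N => Filter.Eventually.of_forall fun t => ?_)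
      (Filter.Eventually.of_forall fun t => (tendsto_gaussPartial a b n t).const_mul _)
    rw [norm_mul]
    calc _ ≤ Real.exp ((dunklLower μ)⁻¹ * |x| * |t|) *
          (|t| ^ n * Real.exp (-((a - |a - b|) * t ^ 2))) :=
          mul_le_mul (norm_genExp_mul_le hμ hω x t) (norm_gaussPartial_le a b n N t)
            (norm_nonneg _) (Real.exp_pos _).le
      _ = _ := by ring
  have hGN : ∀ N, (G ((hF N).toLp (gaussPartial a b n N)) : ℝ → ℂ) =ᵐ[weightMeasure μ]
      transform μ ω (gaussPartial a b n N) := fun N =>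
    (hG _ (gaussPartial_mem_gaussSpan a b n N)).2
  filter_upwards [hae, ae_all_iff.2 hGN] with x h1 h2
  refine tendsto_nhds_unique h1 ?_
  simp only [Function.comp_apply, h2]
  exact (hT x).comp hs.tendsto_atTop

theorem ExtendsOn.of_pos {μ : ℝ} (hμ : -(1 / 2 : ℝ) < μ) {ω : ℂ} (hω : ‖ω‖ = 1) {a b : ℝ}
    (ha : 0 < a) (hb : 0 < b) {G : L2w μ →L[ℂ] L2w μ}
    (hG : ExtendsOn μ a (transform μ ω) G) : ExtendsOn μ b (transform μ ω) G := by
  -- Any ratio strictly between 1 and 2 would do: each step is admissible, and the widths grow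
  -- beyond b. From there b is reached in one step.
  have key : ∀ k : ℕ, ExtendsOn μ ((3 / 2) ^ k * a) (transform μ ω) G := by
    intro k
    induction k with
    | zero => simpa using hG
    | succ k ih =>
      refine ih.of_lt_two_mul hμ hω (by positivity) ?_
      have : 0 < (3 / 2 : ℝ) ^ k * a := by positivity
      rw [pow_succ]
      linarith
  obtain ⟨k, hk⟩ := pow_unbounded_of_one_lt (b / a) (by norm_num : (1 : ℝ) < 3 / 2)
  rw [div_lt_iff₀ ha] at hk
  exact (key k).of_lt_two_mul hμ hω hb (by linarith)

/-- The map `p ↦ p(t) exp(-t²/2)`. -/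
noncomputable def polynomialMulGaussian : Polynomial ℂ →ₗ[ℂ] (ℝ → ℂ) where
  toFun p t := p.eval (t : ℂ) * (Real.exp (-(1 / 2 * t ^ 2)) : ℝ)
  map_add' p q := by
    funext t
    simp only [Polynomial.eval_add, add_mul, Pi.add_apply]
  map_smul' c p := by
    funext t
    simp only [Polynomial.eval_smul, smul_eq_mul, mul_assoc, Pi.smul_apply, RingHom.id_apply]

theorem span_range_hermiteFun {μ : ℝ} (hμ : -(1 / 2 : ℝ) < μ) :
    Submodule.span ℂ (Set.range (hermiteFun μ)) = gaussSpan (1 / 2) := by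
  have h1 : gaussSpan (1 / 2) = LinearMap.range polynomialMulGaussian := by
    rw [LinearMap.range_eq_map, ← (Polynomial.basisMonomials ℂ).span_eq, Submodule.map_span,
      ← Set.range_comp, gaussSpan]
    congr 2
    funext n t
    simp only [Function.comp_apply, Polynomial.coe_basisMonomials, polynomialMulGaussian,
      LinearMap.coe_mk, AddHom.coe_mk, Polynomial.eval_monomial]
    push_cast
    ring
  have h2 : LinearMap.range polynomialMulGaussian
      = Submodule.span ℂ (Set.range fun n => polynomialMulGaussian (hermitePoly μ n)) := by
    rw [LinearMap.range_eq_map, ← span_range_hermitePoly hμ, Submodule.map_span, ← Set.range_comp]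
    rfl
  have h3 : ∀ n, hermiteFun μ n
      = (hermiteConst μ n : ℂ) • polynomialMulGaussian (hermitePoly μ n) := fun n =>
    funext fun t => hermiteFun_eq hμ n t
  rw [h1, h2]
  apply le_antisymm
  · rw [Submodule.span_le]
    rintro _ ⟨n, rfl⟩
    rw [h3]
    exact Submodule.smul_mem _ _ (Submodule.subset_span ⟨n, rfl⟩)
  · rw [Submodule.span_le]
    rintro _ ⟨n, rfl⟩
    have hc : (hermiteConst μ n : ℂ) ≠ 0 := by exact_mod_cast hermiteConst_ne_zero hμ n
    have : polynomialMulGaussian (hermitePoly μ n)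
        = (hermiteConst μ n : ℂ)⁻¹ • hermiteFun μ n := by
      rw [h3, inv_smul_smul₀ hc]
    simp only [this]
    exact Submodule.smul_mem _ _ (Submodule.subset_span ⟨n, rfl⟩)

/-! ### Diagonal operators in the Hermite basis -/

/-- The generalized Hermite functions as a Hilbert basis. -/
noncomputable def hermiteBasis {μ : ℝ} (hμ : -(1 / 2 : ℝ) < μ) : HilbertBasis ℕ ℂ (L2w μ) :=
  HilbertBasis.mk (orthonormal_hermiteFun hμ) (closure_span_hermiteFun hμ).ge

theorem hermiteBasis_apply {μ : ℝ} (hμ : -(1 / 2 : ℝ) < μ) (n : ℕ) :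
    hermiteBasis hμ n = (memLp_hermiteFun hμ n).toLp (hermiteFun μ n) := by
  rw [hermiteBasis, HilbertBasis.coe_mk]

theorem extendsOn_transform_of_apply_hermiteBasis {μ : ℝ} (hμ : -(1 / 2 : ℝ) < μ) {ω : ℂ}
    (hω : ω ^ 2 = -1) {G : L2w μ →L[ℂ] L2w μ}
    (hG : ∀ n, G (hermiteBasis hμ n) = ω ^ n • hermiteBasis hμ n) {a : ℝ} (ha : 0 < a) :
    ExtendsOn μ a (transform μ ω) G := by
  have hω1 := norm_eq_one_of_sq_eq_neg_one hω
  refine ExtendsOn.of_pos hμ hω1 (a := 1 / 2) (by norm_num) ha ?_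
  refine extendsOn_of_spanning hμ hω1 (by norm_num) G (hermiteFun μ)
    (span_range_hermiteFun hμ) fun n => ⟨memLp_hermiteFun hμ n, ?_⟩
  rw [← hermiteBasis_apply hμ, hG, hermiteBasis_apply]
  filter_upwards [Lp.coeFn_smul (ω ^ n) ((memLp_hermiteFun hμ n).toLp (hermiteFun μ n)),
    (memLp_hermiteFun hμ n).coeFn_toLp] with x h1 h2
  rw [h1, Pi.smul_apply, h2, transform_hermiteFun hμ hω, smul_eq_mul]

/-- This is the source of uniqueness: the formula on one Gaussian span transfers to a = 1/2, whose
span contains every φ_n. -/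
theorem apply_hermiteBasis_of_extendsOn_transform {μ : ℝ} (hμ : -(1 / 2 : ℝ) < μ) {ω : ℂ}
    (hω : ω ^ 2 = -1) {G : L2w μ →L[ℂ] L2w μ} {a : ℝ} (ha : 0 < a)
    (hG : ExtendsOn μ a (transform μ ω) G) (n : ℕ) :
    G (hermiteBasis hμ n) = ω ^ n • hermiteBasis hμ n := by
  have h := ExtendsOn.of_pos hμ (norm_eq_one_of_sq_eq_neg_one hω) (b := 1 / 2) ha (by norm_num) hG
  have hmem : hermiteFun μ n ∈ gaussSpan (1 / 2) := by
    rw [← span_range_hermiteFun hμ]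
    exact Submodule.subset_span ⟨n, rfl⟩
  obtain ⟨hf, hn⟩ := h _ hmem
  rw [hermiteBasis_apply]
  apply Lp.ext
  filter_upwards [Lp.coeFn_smul (ω ^ n) ((memLp_hermiteFun hμ n).toLp (hermiteFun μ n)),
    (memLp_hermiteFun hμ n).coeFn_toLp, hn] with x h1 h2 h3
  rw [h1, Pi.smul_apply, h2, h3, transform_hermiteFun hμ hω, smul_eq_mul]

theorem HilbertBasis.continuousLinearMap_ext {E : Type*} [NormedAddCommGroup E]
    [InnerProductSpace ℂ E] (b : HilbertBasis ℕ ℂ E) {G H : E →L[ℂ] E}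
    (h : ∀ n, G (b n) = H (b n)) : G = H := by
  refine ContinuousLinearMap.ext_on (s := Set.range b) ?_ ?_
  · exact (Submodule.dense_iff_topologicalClosure_eq_top).2 b.dense_span
  · rintro _ ⟨n, rfl⟩
    exact h n

/-- A unitary operator which is diagonal with respect to a Hilbert basis. -/
theorem HilbertBasis.exists_diagonal {E : Type*} [NormedAddCommGroup E]
    [InnerProductSpace ℂ E] [CompleteSpace E] (b : HilbertBasis ℕ ℂ E) {c : ℕ → ℂ}
    (hc : ∀ n, ‖c n‖ = 1) : ∃ F : E ≃ₗᵢ[ℂ] E, ∀ n, F (b n) = c n • b n := by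
  have hc0 : ∀ n, c n ≠ 0 := fun n h => by simpa [h] using hc n
  have ho : Orthonormal ℂ fun n => c n • b n := by
    rw [orthonormal_iff_ite]
    intro i j
    rw [inner_smul_left, inner_smul_right, (orthonormal_iff_ite.1 b.orthonormal) i j]
    split_ifs with hij
    · subst hij
      rw [mul_one, mul_comm, Complex.mul_conj, Complex.normSq_eq_norm_sq, hc]
      simp
    · simp
  have hs : (⊤ : Submodule ℂ E)
      ≤ (Submodule.span ℂ (Set.range fun n => c n • b n)).topologicalClosure := by
    rw [← b.dense_span]
    refine Submodule.topologicalClosure_mono (Submodule.span_le.2 ?_)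
    rintro _ ⟨n, rfl⟩
    have : b n = (c n)⁻¹ • (c n • b n) := by rw [inv_smul_smul₀ (hc0 n)]
    rw [this]
    exact Submodule.smul_mem _ _ (Submodule.subset_span ⟨n, rfl⟩)
  classical
  -- The unimodular multiples c_n b_n form another Hilbert basis. The operator takes coordinates in
  -- one basis and reads them in the other.
  refine ⟨b.repr.trans (HilbertBasis.mk ho hs).repr.symm, fun n => ?_⟩
  rw [LinearIsometryEquiv.trans_apply, b.repr_self, HilbertBasis.repr_symm_single,
    HilbertBasis.coe_mk]

/-- The eigenvalues of a diagonal unitary operator are its diagonal entries. -/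
theorem HilbertBasis.exists_eq_of_hasEigenvalue {E : Type*} [NormedAddCommGroup E]
    [InnerProductSpace ℂ E] (b : HilbertBasis ℕ ℂ E) {c : ℕ → ℂ}
    {F : E ≃ₗᵢ[ℂ] E} (hF : ∀ n, F (b n) = c n • b n) (hc : ∀ n, ‖c n‖ = 1) {z : ℂ}
    (hz : Module.End.HasEigenvalue (F.toLinearEquiv : E →ₗ[ℂ] E) z) : ∃ n, z = c n := by
  obtain ⟨v, hv⟩ := hz.exists_hasEigenvector
  have hFv : F v = z • v := hv.apply_eq_smul
  -- Unitarity gives conj(c_n) z ⟨b_n, v⟩ = ⟨b_n, v⟩, and conj(c_n) is the inverse of c_n. Hence z =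
  -- c_n wherever v has a nonzero coordinate.
  have hcoef : ∀ n, z * inner ℂ (b n) v = c n * inner ℂ (b n) v := fun n => by
    have h1 : inner ℂ (F (b n)) (F v) = inner ℂ (b n) v := F.inner_map_map _ _
    rw [hF, hFv, inner_smul_left, inner_smul_right] at h1
    have h2 : c n * (starRingEnd ℂ) (c n) = 1 := by
      rw [Complex.mul_conj, Complex.normSq_eq_norm_sq, hc]
      simp
    linear_combination (-(z * inner ℂ (b n) v)) * h2 + c n * h1
  by_contra hne
  push Not at hne
  refine hv.2 (b.repr.injective ?_)
  ext n
  rw [b.repr_apply_apply, map_zero]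
  by_contra h0
  exact hne n (mul_right_cancel₀ h0 (hcoef n))

/-! ### The main theorem -/

theorem theorem3p6 (μ : ℝ) (hμ : -(1 / 2 : ℝ) < μ) :
    -- the integrals converge
    (∀ a : ℝ, 0 < a → ∀ f ∈ gaussSpan a, ∀ x : ℝ,
      Integrable (fun t : ℝ =>
        genExp μ (-Complex.I * x * t) * f t * ((|t| ^ (2 * μ) : ℝ) : ℂ)) ∧
      Integrable (fun t : ℝ =>
        genExp μ (Complex.I * x * t) * f t * ((|t| ^ (2 * μ) : ℝ) : ℂ))) ∧
    ∃ F : L2w μ ≃ₗᵢ[ℂ] L2w μ,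
      -- `F` extends the integral transform, and is the only bounded operator which does
      (∀ a : ℝ, 0 < a → ExtendsOn μ a (fourierIntegralW μ) F) ∧
      (∀ a : ℝ, 0 < a → ∀ G : L2w μ →L[ℂ] L2w μ, ExtendsOn μ a (fourierIntegralW μ) G →
        ∀ f : L2w μ, G f = F f) ∧
      -- the eigenvalues
      (∀ z : ℂ, Module.End.HasEigenvalue (F.toLinearEquiv : L2w μ →ₗ[ℂ] L2w μ) z ↔
        z = 1 ∨ z = -1 ∨ z = Complex.I ∨ z = -Complex.I) ∧
      -- the generalized Hermite functions are a complete orthonormal set of eigenvectors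
      (∃ hφ : ∀ n : ℕ, MemLp (hermiteFun μ n) 2 (weightMeasure μ),
        Orthonormal ℂ (fun n : ℕ => (hφ n).toLp (hermiteFun μ n)) ∧
        (Submodule.span ℂ
          (Set.range fun n : ℕ => (hφ n).toLp (hermiteFun μ n))).topologicalClosure = ⊤ ∧
        ∀ n : ℕ, Module.End.HasEigenvector (F.toLinearEquiv : L2w μ →ₗ[ℂ] L2w μ)
          ((-Complex.I) ^ n) ((hφ n).toLp (hermiteFun μ n))) ∧
      -- the inverse transform
      (∀ a : ℝ, 0 < a → ExtendsOn μ a (fourierIntegralInvW μ) F.symm) := by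
  have hI : (-Complex.I) ^ 2 = -1 := by simp
  have hI' : Complex.I ^ 2 = -1 := Complex.I_sq
  have hn : ‖-Complex.I‖ = 1 := by simp
  refine ⟨fun a ha f hf x => ⟨?_, ?_⟩, ?_⟩
  · exact integrable_weightMeasure_iff.1 (integrable_genExp_mul_of_mem_gaussSpan hμ hn ha hf x)
  · exact integrable_weightMeasure_iff.1
      (integrable_genExp_mul_of_mem_gaussSpan hμ Complex.norm_I ha hf x)
  have hc : ∀ n : ℕ, ‖(-Complex.I) ^ n‖ = 1 := fun n => by rw [norm_pow, hn, one_pow]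
  obtain ⟨F, hF⟩ := (hermiteBasis hμ).exists_diagonal hc
  have hFsymm : ∀ n, F.symm (hermiteBasis hμ n) = Complex.I ^ n • hermiteBasis hμ n := fun n => by
    rw [LinearIsometryEquiv.symm_apply_eq, map_smul, hF, smul_smul, ← mul_pow]
    simp
  have hvec : ∀ n : ℕ, Module.End.HasEigenvector (F.toLinearEquiv : L2w μ →ₗ[ℂ] L2w μ)
      ((-Complex.I) ^ n) (hermiteBasis hμ n) := fun n =>
    Module.End.hasEigenvector_iff.2 ⟨Module.End.mem_eigenspace_iff.2 (hF n),
      (hermiteBasis hμ).orthonormal.ne_zero n⟩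
  rw [fourierIntegralW_eq_transform, fourierIntegralInvW_eq_transform]
  refine ⟨F, ?_, ?_, ?_, ⟨memLp_hermiteFun hμ, orthonormal_hermiteFun hμ,
    closure_span_hermiteFun hμ, fun n => hermiteBasis_apply hμ n ▸ hvec n⟩, ?_⟩
  · exact fun a ha => extendsOn_transform_of_apply_hermiteBasis hμ hI
      (G := F.toContinuousLinearEquiv.toContinuousLinearMap) hF ha
  · intro a ha G hG f
    have h := (hermiteBasis hμ).continuousLinearMap_ext (G := G)
      (H := F.toContinuousLinearEquiv.toContinuousLinearMap) fun n =>
        (apply_hermiteBasis_of_extendsOn_transform hμ hI ha hG n).trans (hF n).symm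
    rw [h]
    rfl
  · intro z
    constructor
    · intro hz
      obtain ⟨n, rfl⟩ := (hermiteBasis hμ).exists_eq_of_hasEigenvalue hF hc hz
      have h4 : ((-Complex.I) ^ n) ^ 4 = 1 := by
        rw [← pow_mul, mul_comm, pow_mul, show (-Complex.I) ^ 4 = ((-Complex.I) ^ 2) ^ 2 by ring,
          hI]
        simp
      generalize (-Complex.I) ^ n = z at h4
      -- Every power of -i is a root of z⁴ - 1, which factors completely over ℂ.
      have : (z - 1) * ((z + 1) * ((z - Complex.I) * (z + Complex.I))) = 0 := by
        linear_combination h4 + (1 - z ^ 2) * hI'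
      rcases mul_eq_zero.1 this with h | h
      · exact Or.inl (sub_eq_zero.1 h)
      rcases mul_eq_zero.1 h with h | h
      · exact Or.inr (Or.inl (eq_neg_of_add_eq_zero_left h))
      rcases mul_eq_zero.1 h with h | h
      · exact Or.inr (Or.inr (Or.inl (sub_eq_zero.1 h)))
      · exact Or.inr (Or.inr (Or.inr (eq_neg_of_add_eq_zero_left h)))
    · have hval := fun n => Module.End.hasEigenvalue_of_hasEigenvector (hvec n)
      rintro (rfl | rfl | rfl | rfl)
      · simpa using hval 0
      · simpa using hval 2
      · have := hval 3
        rwa [pow_succ, hI, neg_one_mul, neg_neg] at this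
      · simpa using hval 1
  · exact fun a ha => extendsOn_transform_of_apply_hermiteBasis hμ hI'
      (G := F.symm.toContinuousLinearEquiv.toContinuousLinearMap) hFsymm ha
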